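/- Write $\|\cdot\|$ for the Euclidean norm of vectors and the spectral norm of matrices, $\odot$ for the entrywise product, and $\mathrm{relu}(v)=\max(v,0)$ entrywise. Multi-head attention (MHA). Let $X=[x_1,\dots,x_T]^\top\in\mathbb{R}^{T\times d_1}$ be a sequence of tokens, and let $a_1,\dots,a_T\in\{0,1\}^T$ be attention masks with $\|a_i\|_1\ge 1$ for each $i$. For projections $W_Q^{(j)},W_K^{(j)}\in\mathbb{R}^{d_1\times d_K}$, $W_V^{(j)}\in\mathbb{R}^{d_1\times d_V}$, $W_O^{(j)}\in\mathbb{R}^{d_V\times d_1}$ ($1\le j\le H$), put $$\mathrm{attn}(x_i)=\sum_{j=1}^H \sigma\!\left(\frac{x_i^\top W_Q^{(j)}\,(XW_K^{(j)})^\top}{\sqrt{d_K}};a_i\right)XW_V^{(j)}W_O^{(j)},\qquad \sigma(z;a)_k=\frac{a_k e^{z_k}}{\sum_{l} a_l e^{z_l}} .$$ Target block. Let $H,L,d_1,d_K\ge 1$ and $$\mathrm{blk}_{\mathrm T}(x_i)=\mathrm{FC}_{\mathrm T}(\mathrm{attn}_{\mathrm T}(x_i)^\top+x_i)+\mathrm{attn}_{\mathrm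 T}(x_i)^\top+x_i,\qquad \mathrm{FC}_{\mathrm T}(x)=W_L\,\mathrm{relu}(W_{L-1}\cdots\mathrm{relu}(W_1x)),$$ where $\mathrm{attn}_{\mathrm T}$ is an MHA with $H$ heads as above, $W_1,\dots,W_L\in\mathbb{R}^{d_1\times d_1}$, and all the matrices $W_Q^{(j)},W_K^{(j)},W_V^{(j)},W_O^{(j)},W_l$ have spectral norm at most $1$. Source block. Let $$\mathrm{blk}_{\mathrm S}(x_i)=\mathrm{FC}_{\mathrm S}(\mathrm{attn}_{\mathrm S}(x_i)^\top+x_i)+\mathrm{attn}_{\mathrm S}(x_i)^\top+x_i,$$ where $\mathrm{attn}_{\mathrm S}$ is an MHA with $H$ heads whose key and value dimensions are both $n_{\mathrm{MHA}}$ (so its logits are divided by $\sqrt{n_{\mathrm{MHA}}}$), and $\mathrm{FC}_{\mathrm S}$ is a ReLU network with $2L$ layers (no ReLU after the last layer), whose odd layers are $n_{\mathrm{FC}}\times d_1$ matrices and whose even layers are $d_1\times n_{\mathrm{FC}}$ matrices. Each weight matrix of the source block is of the form $\tilde W\odot M$ with $\tilde W$ random and $M$ a binary pruning mask. All entries of all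 the matrices $\tilde W$ are independent, those of the query and key projections uniform on $[-n_{\mathrm{MHA}}^{1/4},n_{\mathrm{MHA}}^{1/4}]$, and all others uniform on $[-1,1]$. Theorem. There is a universal constant $C>0$ such that the following holds. Let $0<\epsilon<1$, let $\alpha\ge\sqrt{d_1}$, fix a target block as above, and suppose that $$n_{\mathrm{MHA}}\ge d_1C\log\!\left(\frac{32\,\alpha^3Hd_1^{3/2}}{\epsilon}\right),\qquad n_{\mathrm{FC}}\ge d_1C\log\!\left(\frac{24\,\alpha LHd_1^{5/2}}{\epsilon}\right).$$ Then, with probability at least $1-\epsilon$ over the random weights, there is a choice of binary pruning masks such that $$\max_{1\le i\le T}\|\mathrm{blk}_{\mathrm S}(x_i)-\mathrm{blk}_{\mathrm T}(x_i)\|\le\epsilon$$ for every $T\ge 1$, all tokens $x_1,\dots,x_T\in\mathbb{R}^{d_1}$ with $\|x_i\|\le\alpha$, and all attention masks $a_1,\dots,a_T$ with $\|a_i\|_1\ge 1$. -/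

import Mathlib

open scoped Matrix
open MeasureTheory ProbabilityTheory

noncomputable section

namespace TransformerSLT

/-- Euclidean norm of a real vector. -/
def l2norm {k : ℕ} (v : Fin k → ℝ) : ℝ := ‖WithLp.toLp 2 v‖

open scoped Matrix.Norms.L2Operator in
/-- Spectral norm of a real matrix: the operator norm between Euclidean spaces. -/
def specNorm {k l : ℕ} (W : Matrix (Fin k) (Fin l) ℝ) : ℝ := ‖W‖

/-- Entrywise ReLU. -/
def relu {k : ℕ} (v : Fin k → ℝ) : Fin k → ℝ := fun i => max (v i) 0

/-- Softmax of the logits `z` with the binary attention mask `a`. -/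
def softmax {T : ℕ} (a : Fin T → Bool) (z : Fin T → ℝ) : Fin T → ℝ := fun k =>
  (if a k then Real.exp (z k) else 0) / ∑ l, if a l then Real.exp (z l) else 0

/-- The projections of a multi-head attention with `H` heads, embedding dimension `d`, key
dimension `dK` and value dimension `dV`; `O j` is the block of the output projection that
belongs to head `j`. -/
structure MHAWeights (H d dK dV : ℕ) where
  Q : Fin H → Matrix (Fin d) (Fin dK) ℝ
  K : Fin H → Matrix (Fin d) (Fin dK) ℝ
  V : Fin H → Matrix (Fin d) (Fin dV) ℝ
  O : Fin H → Matrix (Fin dV) (Fin d) ℝ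

namespace MHAWeights

variable {H d dK dV T : ℕ}

/-- Output of head `j` at token `i`: `softmax (qᵢ Kᵀ / √dK; aᵢ) V` with `qᵢ = xᵢᵀ W_Q`,
`K = X W_K`, `V = X W_V`. The rows of `X` are the tokens, and `a i k` says that token `i`
attends to token `k`. -/
def head (W : MHAWeights H d dK dV) (X : Matrix (Fin T) (Fin d) ℝ) (a : Fin T → Fin T → Bool)
    (j : Fin H) (i : Fin T) : Fin dV → ℝ :=
  softmax (a i) ((√(dK : ℝ))⁻¹ • ((X i ᵥ* W.Q j) ᵥ* (X * W.K j)ᵀ)) ᵥ* (X * W.V j)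

/-- Output of the multi-head attention at token `i`. -/
def attn (W : MHAWeights H d dK dV) (X : Matrix (Fin T) (Fin d) ℝ) (a : Fin T → Fin T → Bool)
    (i : Fin T) : Fin d → ℝ :=
  ∑ j, W.head X a j i ᵥ* W.O j

end MHAWeights

/-- The fully-connected network `x ↦ W_L relu (W_{L-1} ⋯ relu (W_1 x))` with `L ≥ 1` layers of
width `d`, where `W_{l+1} = W l`. (With no layers: the identity.) -/
def targetFC {d : ℕ} : {L : ℕ} → (Fin L → Matrix (Fin d) (Fin d) ℝ) → (Fin d → ℝ) → (Fin d → ℝ)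
  | 0, _, x => x
  | 1, W, x => W 0 *ᵥ x
  | _ + 2, W, x => targetFC (fun l => W l.succ) (relu (W 0 *ᵥ x))

/-- The fully-connected network `x ↦ W_{2L} relu (W_{2L-1} ⋯ relu (W_2 relu (W_1 x)))` with `2L`
layers, `L ≥ 1`, where `W_{2l+1} = A l` maps dimension `d` to the hidden dimension `m`, and
`W_{2l+2} = B l` maps dimension `m` to dimension `d`. (With no layers: the identity.) -/
def sourceFC {d m : ℕ} : {L : ℕ} → (Fin L → Matrix (Fin m) (Fin d) ℝ) →
    (Fin L → Matrix (Fin d) (Fin m) ℝ) → (Fin d → ℝ) → (Fin d → ℝ)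
  | 0, _, _, x => x
  | 1, A, B, x => B 0 *ᵥ relu (A 0 *ᵥ x)
  | _ + 2, A, B, x =>
      sourceFC (fun l => A l.succ) (fun l => B l.succ) (relu (B 0 *ᵥ relu (A 0 *ᵥ x)))

/-- Weights of a target block. -/
structure TargetWeights (H L d dK dV : ℕ) where
  mha : MHAWeights H d dK dV
  fc : Fin L → Matrix (Fin d) (Fin d) ℝ

/-- Every weight matrix of the target block has spectral norm at most one. -/
def TargetWeights.NormLeOne {H L d dK dV : ℕ} (W : TargetWeights H L d dK dV) : Prop :=
  (∀ j, specNorm (W.mha.Q j) ≤ 1 ∧ specNorm (W.mha.K j) ≤ 1 ∧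
    specNorm (W.mha.V j) ≤ 1 ∧ specNorm (W.mha.O j) ≤ 1) ∧
  ∀ l, specNorm (W.fc l) ≤ 1

/-- The target block `xᵢ ↦ FC (attn xᵢ + xᵢ) + attn xᵢ + xᵢ`. -/
def TargetWeights.block {H L d dK dV T : ℕ} (W : TargetWeights H L d dK dV)
    (X : Matrix (Fin T) (Fin d) ℝ) (a : Fin T → Fin T → Bool) (i : Fin T) : Fin d → ℝ :=
  targetFC W.fc (W.mha.attn X a i + X i) + W.mha.attn X a i + X i

/-- Weights of a source block: attention with key and value dimension `n`, and a fully-connected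
network with `2L` layers and hidden dimension `m`. -/
structure SourceWeights (H L d n m : ℕ) where
  mha : MHAWeights H d n n
  fcOdd : Fin L → Matrix (Fin m) (Fin d) ℝ
  fcEven : Fin L → Matrix (Fin d) (Fin m) ℝ

/-- The source block `xᵢ ↦ FC (attn xᵢ + xᵢ) + attn xᵢ + xᵢ`. -/
def SourceWeights.block {H L d n m T : ℕ} (W : SourceWeights H L d n m)
    (X : Matrix (Fin T) (Fin d) ℝ) (a : Fin T → Fin T → Bool) (i : Fin T) : Fin d → ℝ :=
  sourceFC W.fcOdd W.fcEven (W.mha.attn X a i + X i) + W.mha.attn X a i + X i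

/-- The positions of the scalar weights of a source block. -/
inductive SourceIndex (H L d n m : ℕ) : Type
  | Q (j : Fin H) (r : Fin d) (c : Fin n)
  | K (j : Fin H) (r : Fin d) (c : Fin n)
  | V (j : Fin H) (r : Fin d) (c : Fin n)
  | O (j : Fin H) (r : Fin n) (c : Fin d)
  | fcOdd (l : Fin L) (r : Fin m) (c : Fin d)
  | fcEven (l : Fin L) (r : Fin d) (c : Fin m)

/-- Half-width of the initialization interval of a weight: `n^{1/4}` for the query and key
projections, `1` for all other weights. -/
def SourceIndex.halfWidth {H L d n m : ℕ} : SourceIndex H L d n m → ℝ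
  | .Q _ _ _ => (n : ℝ) ^ (1 / 4 : ℝ)
  | .K _ _ _ => (n : ℝ) ^ (1 / 4 : ℝ)
  | _ => 1

/-- Assemble the source weights from their scalar entries. -/
def SourceWeights.ofEntries {H L d n m : ℕ} (w : SourceIndex H L d n m → ℝ) :
    SourceWeights H L d n m where
  mha :=
    { Q := fun j => Matrix.of fun r c => w (.Q j r c)
      K := fun j => Matrix.of fun r c => w (.K j r c)
      V := fun j => Matrix.of fun r c => w (.V j r c)
      O := fun j => Matrix.of fun r c => w (.O j r c) }
  fcOdd := fun l => Matrix.of fun r c => w (.fcOdd l r c)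
  fcEven := fun l => Matrix.of fun r c => w (.fcEven l r c)

/-- Pruning: the entrywise product of the weights with a binary mask. -/
def prune {ι : Type} (w : ι → ℝ) (M : ι → Bool) : ι → ℝ := fun p => w p * if M p then 1 else 0

/-- The scalar weights are independent, each uniform on its initialization interval. -/
structure IsRandomInit {Ω : Type*} [MeasurableSpace Ω] (μ : Measure Ω) {H L d n m : ℕ}
    (w : SourceIndex H L d n m → Ω → ℝ) : Prop where
  measurable : ∀ p, Measurable (w p)
  indep : iIndepFun w μ
  uniform : ∀ p, pdf.IsUniform (w p) (Set.Icc (-p.halfWidth) p.halfWidth) μ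

end TransformerSLT

end

/-! The block error is controlled by a few matrices: for each head the bilinear form `Q Kᵀ / √dK`
and the product `V O`, and the layers of the network. For the target, spectral norms at most one
force every entry of these into `[-1, 1]`. In the source, the hidden units are split into `d`
groups; one factor of each product is pruned so that a group serves a single coordinate, and the
mask of the other factor then selects freely inside the group. Each entry of the source product thus
becomes a subset sum of products of two independent uniform variables (`exists_mask`). A ReLU
between the factors is harmless: a hidden unit fed by one coordinate returns a multiple of its
positive or negative part, according to the sign of the incoming weight.

It remains to see that logarithmically many such products have dense subset sums. Start with a small
interval `A` around `0` and let `m` be the measure of its part in `[-1/4, 1/4]`. Adding a random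
translate is expected to cover a fixed fraction of `m` times the uncovered measure. The potential
`(1/2)/m - 1` turns this into a contraction by `31/32` (`lintegral_deficit_step`), which handles
both the growth of a small `m` and the decay of a small uncovered set. Markov's inequality gives
`measure_not_dense_le`, hence `measure_not_approximates_le`, and a union bound over all entries
gives `measure_not_all_approximate_le`.

The rest is deterministic perturbation theory, collected in `l2norm_block_sub_le`. Its bounds see
the tokens only through their norms and do not involve `T`, so one mask serves all sequences. -/

noncomputable section
namespace TransformerSLT

/-! ### Random subset sums -/

/-- The interval `[-1/4, 1/4]` on which subset sums are shown to be dense. -/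
def coreInterval : Set ℝ := Set.Icc (-(1 / 4)) (1 / 4)

/-- The sum of the entries of `x` selected by `S`. -/
def subsetSum {ι : Type*} [Fintype ι] (x : ι → ℝ) (S : ι → Bool) : ℝ :=
  ∑ i, if S i then x i else 0

/-- The union of the translates of `A` by the subset sums of `x`. -/
def translates {t : ℕ} (A : Set ℝ) (x : Fin t → ℝ) : Set ℝ :=
  {z | ∃ S : Fin t → Bool, z - subsetSum x S ∈ A}

/-- The normalised deficit of a subset of measure `m` of an interval of length `1/2`. -/
def deficit (m : ℝ) : ℝ := (1 / 2) / m - 1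

/-- A measure dominates `1/8` of Lebesgue measure on `[-1/2, 1/2]`. -/
def Spread (ν : Measure ℝ) : Prop :=
  ∀ B : Set ℝ, MeasurableSet B → B ⊆ Set.Icc (-(1 / 2)) (1 / 2) →
    ENNReal.ofReal (1 / 8) * volume B ≤ ν B

lemma measurableSet_coreInterval : MeasurableSet coreInterval := measurableSet_Icc

lemma volume_coreInterval : volume coreInterval = ENNReal.ofReal (1 / 2) := by
  rw [coreInterval, Real.volume_Icc]; norm_num

lemma volume_inter_coreInterval_ne_top (A : Set ℝ) : volume (A ∩ coreInterval) ≠ ⊤ :=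
  ne_top_of_le_ne_top (by rw [volume_coreInterval]; exact ENNReal.ofReal_ne_top)
    (measure_mono Set.inter_subset_right)

lemma measureReal_inter_coreInterval_le (A : Set ℝ) : volume.real (A ∩ coreInterval) ≤ 1 / 2 := by
  have := measureReal_mono (μ := volume) (Set.inter_subset_right (s := A) (t := coreInterval))
    (by rw [volume_coreInterval]; exact ENNReal.ofReal_ne_top)
  rwa [measureReal_def volume coreInterval, volume_coreInterval,
    ENNReal.toReal_ofReal (by norm_num)] at this

lemma deficit_nonneg {m : ℝ} (h0 : 0 < m) (h1 : m ≤ 1 / 2) : 0 ≤ deficit m := by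
  rw [deficit, sub_nonneg, le_div_iff₀ h0]; linarith

lemma deficit_anti {m m' : ℝ} (h0 : 0 < m) (h : m ≤ m') : deficit m' ≤ deficit m := by
  unfold deficit; gcongr

/-- The exact drop is `Δ / (2 m (m + Δ))`, and `m + Δ ≤ 2 m`. A bound linear in `Δ` is what can be
integrated. -/
lemma deficit_add_le {m Δ : ℝ} (h0 : 0 < m) (hΔ : 0 ≤ Δ) (h : Δ ≤ m) :
    deficit (m + Δ) ≤ deficit m - Δ / (4 * m ^ 2) := by
  unfold deficit
  have : (1 / 2) / m - Δ / (4 * m ^ 2) - (1 / 2) / (m + Δ)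
      = Δ * (m - Δ) / (4 * m ^ 2 * (m + Δ)) := by
    have : m + Δ ≠ 0 := by positivity
    field_simp; ring
  have h2 : 0 ≤ Δ * (m - Δ) / (4 * m ^ 2 * (m + Δ)) :=
    div_nonneg (mul_nonneg hΔ (by linarith)) (by positivity)
  linarith

lemma measurableSet_translates_graph {t : ℕ} {A : Set ℝ} (hA : MeasurableSet A) :
    MeasurableSet {p : (Fin t → ℝ) × ℝ | p.2 ∈ translates A p.1} := by
  have : {p : (Fin t → ℝ) × ℝ | p.2 ∈ translates A p.1}
      = ⋃ S : Fin t → Bool, (fun p : (Fin t → ℝ) × ℝ => p.2 - subsetSum p.1 S) ⁻¹' A := by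
    ext; simp [translates]
  rw [this]
  refine MeasurableSet.iUnion fun S => hA.preimage ?_
  refine measurable_snd.sub (Finset.measurable_sum _ fun i _ => ?_)
  split_ifs
  · exact (measurable_pi_apply i).comp measurable_fst
  · exact measurable_const

lemma measurable_volume_translates {t : ℕ} {A : Set ℝ} (hA : MeasurableSet A) :
    Measurable fun x : Fin t → ℝ => volume.real (translates A x ∩ coreInterval) := by
  refine Measurable.ennreal_toReal ?_
  exact measurable_measure_prodMk_left ((measurableSet_translates_graph hA).inter
    (measurable_snd measurableSet_coreInterval))

lemma measurable_deficit : Measurable deficit := by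
  unfold deficit; fun_prop

lemma translates_zero (A : Set ℝ) (x : Fin 0 → ℝ) : translates A x = A := by
  ext z; simp [translates, subsetSum]

lemma subset_translates {t : ℕ} (A : Set ℝ) (x : Fin t → ℝ) : A ⊆ translates A x :=
  fun z hz => ⟨fun _ => false, by simpa [subsetSum] using hz⟩

/-- Using or omitting the first summand can be absorbed into the starting set, which makes an
induction on the number of summands possible. -/
lemma translates_cons {t : ℕ} (A : Set ℝ) (x₀ : ℝ) (x : Fin t → ℝ) :
    translates A (Fin.cons x₀ x : Fin (t + 1) → ℝ)
      = translates (A ∪ {z | z - x₀ ∈ A}) x := by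
  ext z
  simp only [translates, subsetSum, Set.mem_ofPred_eq, Fin.exists_fin_succ_pi, Fin.sum_univ_succ,
    Fin.cons_zero, Fin.cons_succ, Bool.exists_bool, Set.mem_union, exists_or]
  simp [sub_sub, add_comm]

/-- The part of `A ∩ I` that the translation by `x` moves into `I \ A`. -/
def gain (A : Set ℝ) (x : ℝ) : Set ℝ :=
  {z | z - x ∈ A ∩ coreInterval} ∩ (coreInterval \ A)

/-- By Fubini, fix a point `z` of `I \ A`. The shifts that cover it form the reflected translate `z
- (A ∩ I)`, which lies in `[-1/2, 1/2]` because both `z` and `A ∩ I` lie in `[-1/4, 1/4]`, so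
`Spread` applies to it. -/
lemma lintegral_gain_ge {ν : Measure ℝ} [SFinite ν] (hν : Spread ν) {A : Set ℝ}
    (hA : MeasurableSet A) :
    ENNReal.ofReal (1 / 8) * volume (A ∩ coreInterval) * volume (coreInterval \ A)
      ≤ ∫⁻ x, volume (gain A x) ∂ν := by
  have hI := measurableSet_coreInterval
  set s : Set (ℝ × ℝ) := {p | p.2 - p.1 ∈ A ∩ coreInterval} ∩ {p | p.2 ∈ coreInterval \ A}
  have hs : MeasurableSet s :=
    ((hA.inter hI).preimage (measurable_snd.sub measurable_fst)).inter
      ((hI.diff hA).preimage measurable_snd)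
  have h1 : ∫⁻ x, volume (gain A x) ∂ν = (ν.prod volume) s := by
    rw [Measure.prod_apply hs]; rfl
  rw [h1, Measure.prod_apply_symm hs, ← setLIntegral_const, ← lintegral_indicator (hI.diff hA)]
  refine lintegral_mono fun z => ?_
  by_cases hz : z ∈ coreInterval \ A
  · rw [Set.indicator_of_mem hz]
    have h2 : (fun x => (x, z)) ⁻¹' s = (fun x => z - x) ⁻¹' (A ∩ coreInterval) := by
      ext x; simp only [s, Set.mem_preimage, Set.mem_inter_iff, Set.mem_ofPred_eq]; tauto
    rw [h2]
    have h3 : volume ((fun x => z - x) ⁻¹' (A ∩ coreInterval)) = volume (A ∩ coreInterval) :=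
      (Measure.measurePreserving_sub_left volume z).measure_preimage (hA.inter hI).nullMeasurableSet
    rw [← h3]
    refine hν _ ((hA.inter hI).preimage (by fun_prop)) fun x hx => ?_
    have h4 := hx.2
    have h5 := hz.1
    simp only [coreInterval, Set.mem_Icc] at h4 h5 ⊢
    constructor <;> linarith [h4.1, h4.2, h5.1, h5.2]
  · rw [Set.indicator_of_notMem hz]; exact zero_le

/-- The expected gain `m (1/2 - m) / 8`, divided by the `4 m ^ 2` of `deficit_add_le`, is exactly
`1/32` of the deficit. -/
lemma lintegral_deficit_step {ν : Measure ℝ} [IsProbabilityMeasure ν] (hν : Spread ν) {A : Set ℝ}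
    (hA : MeasurableSet A) (h0 : 0 < volume.real (A ∩ coreInterval)) :
    ∫⁻ x, ENNReal.ofReal (deficit (volume.real ((A ∪ {z | z - x ∈ A}) ∩ coreInterval))) ∂ν
      ≤ ENNReal.ofReal (31 / 32) * ENNReal.ofReal (deficit (volume.real (A ∩ coreInterval))) := by
  have hI := measurableSet_coreInterval
  set m := volume.real (A ∩ coreInterval) with hm
  have hm2 : m ≤ 1 / 2 := measureReal_inter_coreInterval_le A
  have hgfin : ∀ x, volume (gain A x) ≠ ⊤ := fun x =>
    ne_top_of_le_ne_top (by rw [volume_coreInterval]; exact ENNReal.ofReal_ne_top)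
      (measure_mono (Set.inter_subset_right.trans Set.sdiff_subset))
  have hgle : ∀ x, volume.real (gain A x) ≤ m := fun x => by
    refine (measureReal_mono (Set.inter_subset_left) ?_).trans_eq ?_
    · have : volume {z | z - x ∈ A ∩ coreInterval} = volume (A ∩ coreInterval) :=
        (measurePreserving_sub_right volume x).measure_preimage (hA.inter hI).nullMeasurableSet
      rw [this]; exact volume_inter_coreInterval_ne_top A
    · exact congrArg ENNReal.toReal
        ((measurePreserving_sub_right volume x).measure_preimage (hA.inter hI).nullMeasurableSet)
  have hgmeas : Measurable fun x => volume.real (gain A x) := by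
    refine Measurable.ennreal_toReal ?_
    have hs : MeasurableSet
      ({p | p.2 - p.1 ∈ A ∩ coreInterval} ∩ {p : ℝ × ℝ | p.2 ∈ coreInterval \ A}) :=
      ((hA.inter hI).preimage (measurable_snd.sub measurable_fst)).inter
        ((hI.diff hA).preimage measurable_snd)
    exact measurable_measure_prodMk_left hs
  have hgint : Integrable (fun x => volume.real (gain A x)) ν :=
    Integrable.of_bound hgmeas.aestronglyMeasurable m
      (Filter.Eventually.of_forall fun x => by
        rw [Real.norm_of_nonneg measureReal_nonneg]; exact hgle x)
  have hgain : 1 / 8 * m * (1 / 2 - m) ≤ ∫ x, volume.real (gain A x) ∂ν := by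
    have h1 := lintegral_gain_ge hν hA
    have h2 : ∫⁻ x, volume (gain A x) ∂ν = ENNReal.ofReal (∫ x, volume.real (gain A x) ∂ν) := by
      rw [ofReal_integral_eq_lintegral_ofReal hgint
        (Filter.Eventually.of_forall fun x => measureReal_nonneg)]
      exact lintegral_congr fun x => (ENNReal.ofReal_toReal (hgfin x)).symm
    have h3 : volume.real (coreInterval \ A) = 1 / 2 - m := by
      have := measureReal_inter_add_sdiff (μ := volume) (s := coreInterval) hA
        (by rw [volume_coreInterval]; exact ENNReal.ofReal_ne_top)
      rw [Set.inter_comm, ← hm, measureReal_def volume coreInterval, volume_coreInterval,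
        ENNReal.toReal_ofReal (by norm_num)] at this
      linarith
    have h4 : volume (coreInterval \ A) = ENNReal.ofReal (1 / 2 - m) := by
      rw [← h3, measureReal_def, ENNReal.ofReal_toReal]
      exact ne_top_of_le_ne_top (by rw [volume_coreInterval]; exact ENNReal.ofReal_ne_top)
        (measure_mono Set.sdiff_subset)
    have h5 : volume (A ∩ coreInterval) = ENNReal.ofReal m :=
      (ENNReal.ofReal_toReal (volume_inter_coreInterval_ne_top A)).symm
    rw [h2, h4, h5, ← ENNReal.ofReal_mul (by norm_num), ← ENNReal.ofReal_mul (by positivity)] at h1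
    exact (ENNReal.ofReal_le_ofReal_iff (integral_nonneg fun x => measureReal_nonneg)).1 h1
  have hpt : ∀ x, deficit (volume.real ((A ∪ {z | z - x ∈ A}) ∩ coreInterval))
      ≤ deficit m - volume.real (gain A x) / (4 * m ^ 2) := fun x => by
    refine le_trans (deficit_anti (by positivity) ?_)
      (deficit_add_le h0 measureReal_nonneg (hgle x))
    rw [hm, ← measureReal_union (Set.disjoint_left.2 fun z hz hz' => hz'.2.2 hz.1) ?_
      (volume_inter_coreInterval_ne_top A) (hgfin x)]
    · refine measureReal_mono ?_ (volume_inter_coreInterval_ne_top _)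
      rintro z (hz | hz)
      · exact ⟨Or.inl hz.1, hz.2⟩
      · exact ⟨Or.inr hz.1.1, hz.2.1⟩
    · exact ((hA.inter hI).preimage (by fun_prop)).inter (hI.diff hA)
  have hint : Integrable (fun x => deficit m - volume.real (gain A x) / (4 * m ^ 2)) ν :=
    (integrable_const _).sub (hgint.div_const _)
  have hpos : ∀ x, 0 ≤ deficit (volume.real ((A ∪ {z | z - x ∈ A}) ∩ coreInterval)) := fun x =>
    deficit_nonneg (h0.trans_le (measureReal_mono
      (Set.inter_subset_inter_left _ Set.subset_union_left) (volume_inter_coreInterval_ne_top _)))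
      (measureReal_inter_coreInterval_le _)
  calc _ ≤ ∫⁻ x, ENNReal.ofReal (deficit m - volume.real (gain A x) / (4 * m ^ 2)) ∂ν :=
        lintegral_mono fun x => ENNReal.ofReal_le_ofReal (hpt x)
    _ = ENNReal.ofReal (∫ x, (deficit m - volume.real (gain A x) / (4 * m ^ 2)) ∂ν) :=
        (ofReal_integral_eq_lintegral_ofReal hint
          (Filter.Eventually.of_forall fun x => (hpos x).trans (hpt x))).symm
    _ ≤ _ := by
        rw [← ENNReal.ofReal_mul (by norm_num)]
        refine ENNReal.ofReal_le_ofReal ?_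
        rw [integral_sub (integrable_const _) (hgint.div_const _), integral_const, integral_div]
        simp only [probReal_univ, one_smul]
        have : 1 / 8 * m * (1 / 2 - m) / (4 * m ^ 2)
            ≤ (∫ x, volume.real (gain A x) ∂ν) / (4 * m ^ 2) := by gcongr
        have h6 : 1 / 8 * m * (1 / 2 - m) / (4 * m ^ 2) = 1 / 32 * deficit m := by
          unfold deficit; field_simp; ring
        linarith

/-- The set `A` varies in the induction: the first summand enlarges it, the inductive hypothesis
treats the enlarged set, and one contraction step then averages over the first summand. -/
lemma lintegral_deficit_translates {t : ℕ} (ν : Fin t → Measure ℝ)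
    [∀ i, IsProbabilityMeasure (ν i)] (hν : ∀ i, Spread (ν i)) {A : Set ℝ}
    (hA : MeasurableSet A) (h0 : 0 < volume.real (A ∩ coreInterval)) :
    ∫⁻ x, ENNReal.ofReal (deficit (volume.real (translates A x ∩ coreInterval))) ∂Measure.pi ν
      ≤ ENNReal.ofReal (31 / 32) ^ t
        * ENNReal.ofReal (deficit (volume.real (A ∩ coreInterval))) := by
  induction t generalizing A with
  | zero => simp [translates_zero]
  | succ t ih =>
    have hmp := (measurePreserving_piFinSuccAbove ν 0).symm
    have hmeas : Measurable fun x : Fin (t + 1) → ℝ =>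
        ENNReal.ofReal (deficit (volume.real (translates A x ∩ coreInterval))) :=
      (measurable_deficit.comp (measurable_volume_translates hA)).ennreal_ofReal
    rw [← hmp.lintegral_comp hmeas, lintegral_prod]
    swap
    · exact (hmeas.comp hmp.measurable).aemeasurable
    have hstep : ∀ x₀ : ℝ, ∫⁻ x, ENNReal.ofReal (deficit (volume.real (translates A
        ((MeasurableEquiv.piFinSuccAbove (fun _ => ℝ) 0).symm (x₀, x)) ∩ coreInterval)))
          ∂Measure.pi (fun j => ν (Fin.succAbove 0 j))
        ≤ ENNReal.ofReal (31 / 32) ^ t * ENNReal.ofReal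
          (deficit (volume.real ((A ∪ {z | z - x₀ ∈ A}) ∩ coreInterval))) := fun x₀ => by
      have h1 : ∀ x : Fin t → ℝ, (MeasurableEquiv.piFinSuccAbove (fun _ => ℝ) 0).symm (x₀, x)
          = (Fin.cons x₀ x : Fin (t + 1) → ℝ) := fun x => by
        simp [MeasurableEquiv.piFinSuccAbove, Fin.insertNthEquiv]
      simp only [h1, translates_cons]
      refine ih (fun j => ν (Fin.succAbove 0 j)) (fun j => hν _)
        (hA.union (hA.preimage (by fun_prop))) (h0.trans_le (measureReal_mono
        (Set.inter_subset_inter_left _ Set.subset_union_left)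
        (volume_inter_coreInterval_ne_top _)))
    refine (lintegral_mono hstep).trans ?_
    rw [lintegral_const_mul' _ _ (by finiteness), pow_succ, mul_assoc]
    gcongr
    exact lintegral_deficit_step (hν 0) hA h0

/-- If the deficit of a union of intervals of radius `δ` is small, the centres are dense. -/
lemma exists_subsetSum_near {t : ℕ} {δ : ℝ} (hδ : 0 < δ) (hδ4 : δ ≤ 1 / 4) (x : Fin t → ℝ)
    (h : deficit (volume.real (translates (Set.Icc (-δ) δ) x ∩ coreInterval)) < 2 * δ) {z : ℝ}
    (hz : z ∈ coreInterval) : ∃ S, |subsetSum x S - z| ≤ 2 * δ := by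
  set A := translates (Set.Icc (-δ) δ) x
  have hA : MeasurableSet A :=
    (measurableSet_translates_graph measurableSet_Icc).preimage measurable_prodMk_left
  set m := volume.real (A ∩ coreInterval) with hm
  have hm2 : m ≤ 1 / 2 := measureReal_inter_coreInterval_le A
  have hsub : Set.Icc (-δ) δ ⊆ A ∩ coreInterval := fun z hz =>
    ⟨subset_translates _ x hz, by simp only [coreInterval, Set.mem_Icc] at hz ⊢
                                  constructor <;> linarith [hz.1, hz.2]⟩
  have hm0 : 0 < m := by
    refine lt_of_lt_of_le ?_ (measureReal_mono hsub (volume_inter_coreInterval_ne_top A))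
    rw [measureReal_def, Real.volume_Icc, ENNReal.toReal_ofReal] <;> linarith
  have hcomp : volume.real (coreInterval \ A) = 1 / 2 - m := by
    have := measureReal_inter_add_sdiff (μ := volume) (s := coreInterval) hA
      (by rw [volume_coreInterval]; exact ENNReal.ofReal_ne_top)
    rw [Set.inter_comm, ← hm, measureReal_def volume coreInterval, volume_coreInterval,
      ENNReal.toReal_ofReal (by norm_num)] at this
    linarith
  -- The uncovered measure is the deficit times `m`, and `m ≤ 1/2`; hence no interval of length `δ`
  -- fits into the uncovered set.
  have hsmall : 1 / 2 - m < δ := by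
    have h1 : deficit m * m = 1 / 2 - m := by unfold deficit; field_simp
    have h2 := mul_lt_mul_of_pos_right h hm0
    nlinarith
  have key : ∀ c, Set.Icc c (c + δ) ⊆ coreInterval → ∃ y ∈ Set.Icc c (c + δ), y ∈ A := fun c hc => by
    by_contra! hcon
    have hsub' : Set.Icc c (c + δ) ⊆ coreInterval \ A := fun y hy => ⟨hc hy, hcon y hy⟩
    have h1 := measureReal_mono (μ := volume) hsub'
      (ne_top_of_le_ne_top (by rw [volume_coreInterval]; exact ENNReal.ofReal_ne_top)
        (measure_mono Set.sdiff_subset))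
    rw [hcomp, measureReal_def, Real.volume_Icc, ENNReal.toReal_ofReal (by linarith)] at h1
    linarith
  have : ∃ y ∈ A, |y - z| ≤ δ := by
    simp only [coreInterval, Set.mem_Icc] at hz
    -- The interval of length `δ` ending at `z` is taken towards the centre; since `δ ≤ 1/4` it
    -- stays inside the core interval.
    rcases le_total 0 z with h0 | h0
    · obtain ⟨y, hy, hyA⟩ := key (z - δ) (fun y hy => by
        simp only [coreInterval, Set.mem_Icc] at hy ⊢; constructor <;> linarith [hy.1, hy.2])
      exact ⟨y, hyA, abs_le.2 ⟨by linarith [hy.1], by linarith [hy.2]⟩⟩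
    · obtain ⟨y, hy, hyA⟩ := key z (fun y hy => by
        simp only [coreInterval, Set.mem_Icc] at hy ⊢; constructor <;> linarith [hy.1, hy.2])
      exact ⟨y, hyA, abs_le.2 ⟨by linarith [hy.1], by linarith [hy.2]⟩⟩
  obtain ⟨y, ⟨S, hS⟩, hy⟩ := this
  refine ⟨S, abs_le.2 ?_⟩
  rw [abs_le] at hy
  constructor <;> linarith [hS.1, hS.2, hy.1, hy.2]

/-- Random subset sums: the probability that some point of `[-1/4, 1/4]` is not approximated. -/
lemma measure_not_dense_le {t : ℕ} (ν : Fin t → Measure ℝ)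
    [∀ i, IsProbabilityMeasure (ν i)] (hν : ∀ i, Spread (ν i)) {δ : ℝ} (hδ : 0 < δ)
    (hδ4 : δ ≤ 1 / 4) :
    ∃ B, MeasurableSet B ∧ (∀ x ∉ B, ∀ z ∈ coreInterval, ∃ S, |subsetSum x S - z| ≤ 2 * δ) ∧
      Measure.pi ν B ≤ ENNReal.ofReal ((31 / 32) ^ t / (8 * δ ^ 2)) := by
  set A := Set.Icc (-δ) δ
  have hmeas : Measurable fun x : Fin t → ℝ =>
      ENNReal.ofReal (deficit (volume.real (translates A x ∩ coreInterval))) :=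
    (measurable_deficit.comp (measurable_volume_translates measurableSet_Icc)).ennreal_ofReal
  refine ⟨{x | ENNReal.ofReal (2 * δ) ≤
    ENNReal.ofReal (deficit (volume.real (translates A x ∩ coreInterval)))},
    measurableSet_le measurable_const hmeas, fun x hx z hz => ?_, ?_⟩
  · refine exists_subsetSum_near hδ hδ4 x ?_ hz
    by_contra hcon
    exact hx (ENNReal.ofReal_le_ofReal (not_lt.1 hcon))
  · have hAI : A ∩ coreInterval = A := Set.inter_eq_left.2 fun z hz => by
      simp only [coreInterval, A, Set.mem_Icc] at hz ⊢
      constructor <;> linarith [hz.1, hz.2]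
    have hm : volume.real (A ∩ coreInterval) = 2 * δ := by
      rw [hAI, measureReal_def, Real.volume_Icc, ENNReal.toReal_ofReal] <;> linarith
    -- Markov's inequality at level `2 * δ`; the starting interval has measure `2 * δ`, so its
    -- deficit is at most `1 / (4 * δ)`.
    have h1 := mul_meas_ge_le_lintegral (μ := Measure.pi ν) hmeas (ENNReal.ofReal (2 * δ))
    have h2 := h1.trans (lintegral_deficit_translates ν hν measurableSet_Icc
      (by rw [hm]; positivity))
    rw [hm, ← ENNReal.ofReal_pow (by norm_num), ← ENNReal.ofReal_mul (by positivity)] at h2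
    rw [mul_comm, ← ENNReal.le_div_iff_mul_le (by simp [hδ]) (by simp),
      ← ENNReal.ofReal_div_of_pos (by positivity)] at h2
    refine h2.trans (ENNReal.ofReal_le_ofReal ?_)
    have : deficit (2 * δ) ≤ 1 / (4 * δ) := by
      unfold deficit
      have : 1 / 2 / (2 * δ) = 1 / (4 * δ) := by field_simp; norm_num
      linarith
    calc (31 / 32 : ℝ) ^ t * deficit (2 * δ) / (2 * δ)
        ≤ (31 / 32 : ℝ) ^ t * (1 / (4 * δ)) / (2 * δ) := by gcongr
      _ = _ := by field_simp; norm_num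

/-! ### Laws of products of uniform variables, and independence -/

/-- The uniform distribution on `[-1, 1]`. -/
def unif : Measure ℝ := ENNReal.ofReal (1 / 2) • volume.restrict (Set.Icc (-1) 1)

instance : SFinite unif := by unfold unif; infer_instance

lemma unif_apply {B : Set ℝ} (hB : MeasurableSet B) :
    unif B = ENNReal.ofReal (1 / 2) * volume (B ∩ Set.Icc (-1) 1) := by
  simp [unif, Measure.restrict_apply hB]

lemma map_div_eq_unif {Ω : Type*} [MeasurableSpace Ω] {μ : Measure Ω} {U : Ω → ℝ} {a : ℝ}
    (ha : 0 < a) (hU : Measurable U) (hunif : pdf.IsUniform U (Set.Icc (-a) a) μ) :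
    μ.map (fun ω => U ω / a) = unif := by
  have h1 : μ.map (fun ω => U ω / a) = (μ.map U).map (fun x => x / a) :=
    (Measure.map_map (g := fun x : ℝ => x / a) (by fun_prop) hU).symm
  rw [h1, hunif]
  ext B hB
  rw [Measure.map_apply (by fun_prop) hB, cond_apply measurableSet_Icc, unif_apply hB]
  have h2 : Set.Icc (-a) a ∩ (fun x => x / a) ⁻¹' B
      = (fun x => a⁻¹ * x) ⁻¹' (B ∩ Set.Icc (-1) 1) := by
    ext x
    simp only [Set.mem_inter_iff, Set.mem_Icc, Set.mem_preimage, inv_mul_eq_div, le_div_iff₀ ha,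
      div_le_iff₀ ha, neg_one_mul, one_mul]
    tauto
  rw [h2, Real.volume_preimage_mul_left (by positivity), Real.volume_Icc, ← mul_assoc,
    inv_inv, abs_of_pos ha, ← ENNReal.ofReal_inv_of_pos (by linarith),
    ← ENNReal.ofReal_mul (inv_nonneg.2 (by linarith))]
  congr 2
  field_simp; norm_num

/-- A product of a uniform variable and a function of an independent uniform variable which is
the absolute value on `[1/2, 1]` or on `[-1, -1/2]` has a spread-out law. -/
lemma spread_map_mul {g : ℝ → ℝ} (hg : Measurable g) {s : ℝ} (hs : s = 1 ∨ s = -1)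
    (hgs : ∀ v ∈ Set.Icc (1 / 2 : ℝ) 1, g (s * v) = v) :
    Spread ((unif.prod unif).map fun p => p.1 * g p.2) := by
  intro B hB hBI
  have hmeas : Measurable fun p : ℝ × ℝ => p.1 * g p.2 := by fun_prop
  rw [Measure.map_apply hmeas hB, Measure.prod_apply_symm (hB.preimage hmeas)]
  -- On `J`, which has probability `1/4`, the second factor `g v` lies in `[1/2, 1]`. Given such a
  -- `v`, the product has density at least `1/2` on `[-1/2, 1/2]`, whence the constant `1/8`.
  set J : Set ℝ := (fun v => s * v) ⁻¹' Set.Icc (1 / 2) 1 with hJ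
  have hJm : MeasurableSet J := measurableSet_Icc.preimage (by fun_prop)
  have hJv : unif J = ENNReal.ofReal (1 / 4) := by
    have h1 : J ∩ Set.Icc (-1) 1 = J := by
      refine Set.inter_eq_left.2 fun v hv => ?_
      rcases hs with rfl | rfl <;> simp only [hJ, Set.mem_preimage, Set.mem_Icc] at hv ⊢ <;>
        constructor <;> linarith [hv.1, hv.2]
    rw [unif_apply hJm, h1, hJ, Real.volume_preimage_mul_left (by rcases hs with rfl | rfl <;> simp),
      Real.volume_Icc, ← ENNReal.ofReal_mul (by positivity), ← ENNReal.ofReal_mul (by positivity)]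
    rcases hs with rfl | rfl <;> norm_num
  have hmono : ∀ v ∈ J, ENNReal.ofReal (1 / 2) * volume B
      ≤ unif ((fun u => (u, v)) ⁻¹' ((fun p : ℝ × ℝ => p.1 * g p.2) ⁻¹' B)) := fun v hv => by
    have hss : s * s = 1 := by rcases hs with rfl | rfl <;> norm_num
    have hgv : g v = s * v := by
      have := hgs _ hv
      rwa [← mul_assoc, hss, one_mul] at this
    have h2 : (fun u => (u, v)) ⁻¹' ((fun p : ℝ × ℝ => p.1 * g p.2) ⁻¹' B)
        = (fun u => (s * v) * u) ⁻¹' B := by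
      ext u; simp [hgv, mul_comm]
    obtain ⟨hv1, hv2⟩ : 1 / 2 ≤ s * v ∧ s * v ≤ 1 := hv
    have h3 : (fun u => (s * v) * u) ⁻¹' B ∩ Set.Icc (-1) 1 = (fun u => (s * v) * u) ⁻¹' B := by
      refine Set.inter_eq_left.2 fun u hu => ?_
      have := hBI hu
      simp only [Set.mem_Icc] at this ⊢
      constructor <;> nlinarith [this.1, this.2]
    rw [h2, unif_apply (hB.preimage (by fun_prop)), h3, Real.volume_preimage_mul_left (by linarith)]
    gcongr
    refine le_mul_of_one_le_left zero_le ?_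
    rw [ENNReal.one_le_ofReal, abs_of_nonneg (by positivity)]
    exact (one_le_inv₀ (by linarith)).2 hv2
  calc ENNReal.ofReal (1 / 8) * volume B
      = ENNReal.ofReal (1 / 2) * volume B * unif J := by
        rw [hJv, mul_right_comm, ← ENNReal.ofReal_mul (by norm_num)]; norm_num
    _ = ∫⁻ _ in J, ENNReal.ofReal (1 / 2) * volume B ∂unif := (setLIntegral_const _ _).symm
    _ ≤ ∫⁻ v in J, unif ((fun u => (u, v)) ⁻¹' ((fun p : ℝ × ℝ => p.1 * g p.2) ⁻¹' B)) ∂unif :=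
        setLIntegral_mono' hJm hmono
    _ ≤ _ := setLIntegral_le_lintegral _ _

/-- Blocks of an independent family are independent. -/
lemma iIndepFun_pair {Ω σ : Type*} [MeasurableSpace Ω] {μ : Measure Ω}
    {X : σ → Bool → Ω → ℝ} (mX : ∀ i b, Measurable (X i b))
    (h : iIndepFun (fun (p : (_ : σ) × Bool) ω => X p.1 p.2 ω) μ) :
    iIndepFun (fun i ω => (X i · ω)) μ := by
  have := h.isProbabilityMeasure
  have : ∀ i j, IsProbabilityMeasure (μ.map (X i j)) :=
    fun i j => Measure.isProbabilityMeasure_map (mX i j).aemeasurable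
  rw [iIndepFun_iff_map_fun_eq_infinitePi_map (by fun_prop)]
  have h1 := (iIndepFun_iff_map_fun_eq_infinitePi_map (by fun_prop)).1 h
  -- Currying the product law over all pairs exhibits it as a product of the laws of the blocks.
  have h2 := congrArg (Measure.map (MeasurableEquiv.piCurry fun (_ : σ) (_ : Bool) => ℝ)) h1
  rw [Measure.map_map (by fun_prop) (by fun_prop),
    Measure.infinitePi_map_piCurry (fun i j => μ.map (X i j))] at h2
  have h3 : (MeasurableEquiv.piCurry fun (_ : σ) (_ : Bool) => ℝ)
      ∘ (fun ω (p : (_ : σ) × Bool) => X p.1 p.2 ω) = fun ω i j => X i j ω := by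
    ext; simp [Sigma.curry]
  rw [h3] at h2
  rw [h2]
  congr 1
  funext i
  have h4 : iIndepFun (X i) μ := h.precomp (g := fun b => ⟨i, b⟩) (fun b b' hb => by simpa using hb)
  exact ((iIndepFun_iff_map_fun_eq_infinitePi_map (by fun_prop)).1 h4).symm

/-! ### Approximation of the whole interval `[-1, 1]` -/

/-- Every number in `[-1, 1]` is within `η` of a subset sum of `x`. -/
def Approximates {ι : Type*} [Fintype ι] (x : ι → ℝ) (η : ℝ) : Prop :=
  ∀ z, |z| ≤ 1 → ∃ S : ι → Bool, |subsetSum x S - z| ≤ η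

/-- Each of the four blocks approximates `z / 4`, which lies in the core interval, and the four
errors add up. -/
lemma approximates_of_blocks {t : ℕ} {x : Fin 4 × Fin t → ℝ} {η : ℝ}
    (h : ∀ k, ∀ z ∈ coreInterval, ∃ S, |subsetSum (fun τ => x (k, τ)) S - z| ≤ η / 4) :
    Approximates x η := by
  intro z hz
  rw [abs_le] at hz
  have hz4 : z / 4 ∈ coreInterval := by
    simp only [coreInterval, Set.mem_Icc]; constructor <;> linarith [hz.1, hz.2]
  choose S hS using fun k => h k _ hz4
  refine ⟨fun p => S p.1 p.2, ?_⟩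
  have h1 : subsetSum x (fun p => S p.1 p.2) - z
      = ∑ k, (subsetSum (fun τ => x (k, τ)) (S k) - z / 4) := by
    rw [Finset.sum_sub_distrib, subsetSum, Fintype.sum_prod_type]
    simp [subsetSum]
    ring
  rw [h1]
  refine (Finset.abs_sum_le_sum_abs _ _).trans ((Finset.sum_le_sum fun k _ => hS k).trans ?_)
  simp; linarith

/-- Since `192 = 6 * 32`, the power is at most `D ^ (-6)`, which pays for the `δ⁻²` of Markov's
inequality with `δ = 1 / (8 * D)`. -/
lemma decay_le {t : ℕ} {D : ℝ} (hD : 2 ≤ D) (ht : 192 * Real.log D ≤ t) :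
    (31 / 32 : ℝ) ^ t / (8 * (1 / (8 * D)) ^ 2) ≤ 1 / D := by
  have hD0 : 0 < D := by linarith
  have h1 : (31 / 32 : ℝ) ^ t ≤ (D ^ 6)⁻¹ := by
    calc (31 / 32 : ℝ) ^ t ≤ Real.exp (-(1 / 32)) ^ t := by
          gcongr
          have := Real.add_one_le_exp (-(1 / 32 : ℝ))
          linarith
      _ = Real.exp (-(t / 32)) := by rw [← Real.exp_nat_mul]; congr 1; ring
      _ ≤ Real.exp (-(6 * Real.log D)) := by gcongr; linarith
      _ = _ := by
          rw [Real.exp_neg, ← Nat.cast_ofNat, Real.exp_nat_mul, Real.exp_log hD0]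
  have h2 : 8 * D ^ 3 ≤ D ^ 6 := by
    have : (2 : ℝ) ^ 3 ≤ D ^ 3 := by gcongr
    nlinarith [pow_pos hD0 3]
  calc (31 / 32 : ℝ) ^ t / (8 * (1 / (8 * D)) ^ 2)
      ≤ (D ^ 6)⁻¹ / (8 * (1 / (8 * D)) ^ 2) := by gcongr
    _ = 8 * D ^ 3 / D ^ 6 * (1 / D) := by field_simp
    _ ≤ 1 * (1 / D) := by
        gcongr
        exact (div_le_one (by positivity)).2 h2
    _ = _ := one_mul _

/-- Products of pairs of independent uniform variables approximate `[-1, 1]` by subset sums. -/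
lemma measure_not_approximates_le {Ω ι : Type*} [MeasurableSpace Ω] {μ : Measure Ω}
    {w : ι → Ω → ℝ} (hw : ∀ i, Measurable (w i)) (hind : iIndepFun w μ) {a : ℝ} (ha : 0 < a)
    {t : ℕ} {D : ℝ} (hD : 2 ≤ D) (ht : 192 * Real.log D ≤ t) (p q : Fin 4 × Fin t → ι)
    (hp : p.Injective) (hq : q.Injective) (hpq : ∀ i j, p i ≠ q j)
    (hpu : ∀ i, pdf.IsUniform (w (p i)) (Set.Icc (-a) a) μ)
    (hqu : ∀ i, pdf.IsUniform (w (q i)) (Set.Icc (-a) a) μ)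
    {g : ℝ → ℝ} (hg : Measurable g) {s : ℝ} (hs : s = 1 ∨ s = -1)
    (hgs : ∀ v ∈ Set.Icc (1 / 2 : ℝ) 1, g (s * v) = v) :
    μ {ω | ¬ Approximates (fun i => w (p i) ω / a * g (w (q i) ω / a)) (1 / D)}
      ≤ ENNReal.ofReal (4 / D) := by
  have hprob := hind.isProbabilityMeasure
  set X : Fin 4 × Fin t → Bool → Ω → ℝ := fun i b => if b then w (p i) else w (q i) with hX
  have mX : ∀ i b, Measurable (X i b) := fun i b => by
    simp only [hX]; split_ifs <;> exact hw _
  have hXind : iIndepFun (fun (r : (_ : Fin 4 × Fin t) × Bool) ω => X r.1 r.2 ω) μ := by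
    have h := hind.precomp
      (g := fun r : (_ : Fin 4 × Fin t) × Bool => if r.2 then p r.1 else q r.1) (by
        rintro ⟨i, b⟩ ⟨j, c⟩ h
        cases b <;> cases c <;> simp at h ⊢
        · exact hq h
        · exact hpq _ _ h.symm
        · exact hpq _ _ h
        · exact hp h)
    convert h using 1
    funext ⟨i, b⟩
    cases b <;> simp [hX]
  have hpair := iIndepFun_pair mX hXind
  set Y : Fin 4 × Fin t → Ω → ℝ := fun i ω => w (p i) ω / a * g (w (q i) ω / a) with hY
  have mY : ∀ i, Measurable (Y i) := fun i => by
    have := hw (p i); have := hw (q i); fun_prop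
  have hYind : iIndepFun Y μ := by
    have h := hpair.comp (fun _ (v : Bool → ℝ) => v true / a * g (v false / a))
      (fun _ => by fun_prop)
    convert h using 1
    funext i ω
    simp [hX, hY]
  have hlaw : ∀ i, Spread (μ.map (Y i)) := fun i => by
    have h1 : IndepFun (fun ω => w (p i) ω / a) (fun ω => w (q i) ω / a) μ :=
      (hind.indepFun (hpq i i)).comp (φ := fun x => x / a) (ψ := fun x => x / a)
        (by fun_prop) (by fun_prop)
    have h2 := (indepFun_iff_map_prod_eq_prod_map_map ((hw _).div_const a).aemeasurable
      ((hw _).div_const a).aemeasurable).1 h1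
    rw [map_div_eq_unif ha (hw _) (hpu i), map_div_eq_unif ha (hw _) (hqu i)] at h2
    have h3 := spread_map_mul hg hs hgs
    rw [← h2, Measure.map_map (by fun_prop)
      (((hw _).div_const a).prodMk ((hw _).div_const a))] at h3
    exact h3
  have hD0 : 0 < D := by linarith
  have hblock : ∀ k : Fin 4, ∃ B : Set (Fin t → ℝ), MeasurableSet B ∧
      (∀ x ∉ B, ∀ z ∈ coreInterval, ∃ S, |subsetSum x S - z| ≤ 2 * (1 / (8 * D))) ∧
      μ ((fun ω τ => Y (k, τ) ω) ⁻¹' B) ≤ ENNReal.ofReal (1 / D) := fun k => by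
    have : ∀ τ, IsProbabilityMeasure (μ.map (Y (k, τ))) :=
      fun τ => Measure.isProbabilityMeasure_map (mY _).aemeasurable
    -- With this `δ`, the precision `2 * δ` is a quarter of `1 / D`, as the four blocks require.
    obtain ⟨B, hB, h1, h2⟩ := measure_not_dense_le (fun τ => μ.map (Y (k, τ)))
      (fun τ => hlaw _) (δ := 1 / (8 * D)) (by positivity)
      (by rw [div_le_div_iff₀ (by positivity) (by norm_num)]; linarith)
    refine ⟨B, hB, h1, ?_⟩
    have h3 : iIndepFun (fun τ => Y (k, τ)) μ :=
      hYind.precomp (g := fun τ => (k, τ)) (fun τ τ' h => by simpa using h)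
    have h4 := (iIndepFun_iff_map_fun_eq_pi_map (fun τ => (mY _).aemeasurable)).1 h3
    rw [← h4, Measure.map_apply (measurable_pi_lambda _ fun τ => mY _) hB] at h2
    exact h2.trans (ENNReal.ofReal_le_ofReal (decay_le hD ht))
  choose B hB h1 h2 using hblock
  have hsub : {ω | ¬ Approximates (fun i => Y i ω) (1 / D)}
      ⊆ ⋃ k, (fun ω τ => Y (k, τ) ω) ⁻¹' B k := by
    intro ω hω
    by_contra hcon
    simp only [Set.mem_iUnion, Set.mem_preimage, not_exists] at hcon
    refine hω (approximates_of_blocks fun k z hz => ?_)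
    obtain ⟨S, hS⟩ := h1 k _ (hcon k) z hz
    exact ⟨S, hS.trans_eq (by field_simp; norm_num)⟩
  refine (measure_mono hsub).trans ((measure_iUnion_fintype_le _ _).trans
    ((Finset.sum_le_sum fun k _ => h2 k).trans ?_))
  rw [Finset.sum_const, Finset.card_univ, Fintype.card_fin, nsmul_eq_mul, ← ENNReal.ofReal_natCast,
    ← ENNReal.ofReal_mul (by norm_num)]
  exact ENNReal.ofReal_le_ofReal (by push_cast; linarith [show 4 * (1 / D) = 4 / D by ring])

/-! ### Euclidean and spectral norms -/

section Norms

variable {k l d : ℕ}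

lemma l2norm_nonneg (v : Fin k → ℝ) : 0 ≤ l2norm v := norm_nonneg _

lemma l2norm_add_le (u v : Fin k → ℝ) : l2norm (u + v) ≤ l2norm u + l2norm v :=
  norm_add_le (WithLp.toLp 2 u) (WithLp.toLp 2 v)

lemma l2norm_smul (c : ℝ) (v : Fin k → ℝ) : l2norm (c • v) = |c| * l2norm v :=
  norm_smul c (WithLp.toLp 2 v)

lemma l2norm_sum_le {ι : Type*} (s : Finset ι) (f : ι → Fin k → ℝ) :
    l2norm (∑ i ∈ s, f i) ≤ ∑ i ∈ s, l2norm (f i) := by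
  unfold l2norm
  rw [WithLp.toLp_sum]
  exact norm_sum_le _ _

lemma l2norm_sq (v : Fin k → ℝ) : l2norm v ^ 2 = ∑ i, v i ^ 2 := by
  simp [l2norm, EuclideanSpace.norm_sq_eq]

lemma abs_apply_le_l2norm (v : Fin k → ℝ) (i : Fin k) : |v i| ≤ l2norm v :=
  PiLp.norm_apply_le (WithLp.toLp 2 v) i

lemma l2norm_mono {u v : Fin k → ℝ} (h : ∀ i, |u i| ≤ |v i|) : l2norm u ≤ l2norm v := by
  rw [← abs_of_nonneg (l2norm_nonneg u), ← abs_of_nonneg (l2norm_nonneg v), ← sq_le_sq, l2norm_sq,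
    l2norm_sq]
  exact Finset.sum_le_sum fun i _ => sq_le_sq.2 (h i)

lemma abs_dotProduct_le (u v : Fin k → ℝ) : |u ⬝ᵥ v| ≤ l2norm u * l2norm v := by
  rw [← abs_of_nonneg (mul_nonneg (l2norm_nonneg u) (l2norm_nonneg v)), ← sq_le_sq, mul_pow,
    l2norm_sq, l2norm_sq]
  exact Finset.sum_mul_sq_le_sq_mul_sq _ _ _

lemma l2norm_mulVec_le (M : Matrix (Fin k) (Fin l) ℝ) (v : Fin l → ℝ) :
    l2norm (M *ᵥ v) ≤ specNorm M * l2norm v :=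
  Matrix.l2_opNorm_mulVec M (WithLp.toLp 2 v)

lemma specNorm_transpose (M : Matrix (Fin k) (Fin l) ℝ) : specNorm Mᵀ = specNorm M := by
  have := Matrix.l2_opNorm_conjTranspose M
  rwa [Matrix.conjTranspose_eq_transpose_of_trivial] at this

lemma l2norm_vecMul_le (M : Matrix (Fin k) (Fin l) ℝ) (v : Fin k → ℝ) :
    l2norm (v ᵥ* M) ≤ specNorm M * l2norm v := by
  rw [← Matrix.mulVec_transpose, ← specNorm_transpose M]
  exact l2norm_mulVec_le _ _

lemma specNorm_nonneg (M : Matrix (Fin k) (Fin l) ℝ) : 0 ≤ specNorm M := by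
  unfold specNorm
  open scoped Matrix.Norms.L2Operator in exact norm_nonneg M

lemma specNorm_mul_le {m : ℕ} (A : Matrix (Fin k) (Fin l) ℝ) (B : Matrix (Fin l) (Fin m) ℝ) :
    specNorm (A * B) ≤ specNorm A * specNorm B := Matrix.l2_opNorm_mul A B

lemma specNorm_smul (c : ℝ) (A : Matrix (Fin k) (Fin l) ℝ) :
    specNorm (c • A) = |c| * specNorm A := by
  unfold specNorm
  open scoped Matrix.Norms.L2Operator in exact norm_smul c A

lemma abs_entry_le_specNorm (M : Matrix (Fin k) (Fin l) ℝ) (r : Fin k) (s : Fin l) :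
    |M r s| ≤ specNorm M := by
  have h1 := abs_apply_le_l2norm (M *ᵥ Pi.single s 1) r
  have h2 := l2norm_mulVec_le M (Pi.single s 1)
  have h3 : l2norm (Pi.single s (1 : ℝ)) = 1 := by
    rw [← sq_eq_sq₀ (l2norm_nonneg _) zero_le_one, l2norm_sq]
    simp [Pi.single_apply]
  rw [h3, mul_one] at h2
  simp only [Matrix.mulVec_single_one, Matrix.col_apply] at h1 h2
  exact h1.trans h2

/-- Cauchy–Schwarz in each row: the Frobenius norm of `E` is at most `d * η`. -/
lemma l2norm_mulVec_le_of_entries {E : Matrix (Fin d) (Fin d) ℝ} {η : ℝ} (hη : 0 ≤ η)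
    (hE : ∀ r s, |E r s| ≤ η) (x : Fin d → ℝ) : l2norm (E *ᵥ x) ≤ d * η * l2norm x := by
  rw [← abs_of_nonneg (l2norm_nonneg (E *ᵥ x)),
    ← abs_of_nonneg (mul_nonneg (by positivity) (l2norm_nonneg x) : 0 ≤ d * η * l2norm x),
    ← sq_le_sq, mul_pow, l2norm_sq, l2norm_sq]
  calc ∑ r, (E *ᵥ x) r ^ 2 ≤ ∑ _r : Fin d, (d * η ^ 2) * ∑ s, x s ^ 2 := by
        refine Finset.sum_le_sum fun r _ => (Finset.sum_mul_sq_le_sq_mul_sq Finset.univ (E r) x).trans ?_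
        gcongr
        calc ∑ s, E r s ^ 2 ≤ ∑ _s : Fin d, η ^ 2 :=
              Finset.sum_le_sum fun s _ => sq_le_sq.2 (by rw [abs_of_nonneg hη]; exact hE r s)
          _ = d * η ^ 2 := by simp
    _ = (d * η) ^ 2 * ∑ s, x s ^ 2 := by simp; ring

lemma l2norm_vecMul_le_of_entries {E : Matrix (Fin d) (Fin d) ℝ} {η : ℝ} (hη : 0 ≤ η)
    (hE : ∀ r s, |E r s| ≤ η) (x : Fin d → ℝ) : l2norm (x ᵥ* E) ≤ d * η * l2norm x := by
  rw [← Matrix.mulVec_transpose]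
  exact l2norm_mulVec_le_of_entries hη (fun r s => hE s r) x

lemma l2norm_relu_le (v : Fin k → ℝ) : l2norm (relu v) ≤ l2norm v := by
  refine l2norm_mono fun i => ?_
  rw [relu, abs_of_nonneg (le_max_right _ _)]
  exact max_le (le_abs_self _) (abs_nonneg _)

lemma l2norm_relu_sub_le (u v : Fin k → ℝ) : l2norm (relu u - relu v) ≤ l2norm (u - v) :=
  l2norm_mono fun i => abs_max_sub_max_le_abs (u i) (v i) 0

end Norms

/-! ### Stability of the masked softmax -/

section Softmax

variable {T : ℕ} {a : Fin T → Bool}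

lemma softmax_denom_pos (ha : ∃ k, a k = true) (z : Fin T → ℝ) :
    0 < ∑ l, if a l then Real.exp (z l) else 0 := by
  obtain ⟨k, hk⟩ := ha
  refine Finset.sum_pos' (fun i _ => by split_ifs <;> positivity) ⟨k, Finset.mem_univ _, ?_⟩
  simp [hk, Real.exp_pos]

lemma softmax_nonneg (a : Fin T → Bool) (z : Fin T → ℝ) (k : Fin T) : 0 ≤ softmax a z k :=
  div_nonneg (by split_ifs <;> positivity)
    (Finset.sum_nonneg fun i _ => by split_ifs <;> positivity)

lemma sum_softmax (ha : ∃ k, a k = true) (z : Fin T → ℝ) : ∑ k, softmax a z k = 1 := by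
  unfold softmax
  rw [← Finset.sum_div]
  exact div_self (softmax_denom_pos ha z).ne'

/-- Numerator and denominator each change by a factor of at most `exp β`. -/
lemma softmax_le_exp_mul (ha : ∃ k, a k = true) {z z' : Fin T → ℝ} {β : ℝ}
    (h : ∀ k, |z k - z' k| ≤ β) (k : Fin T) :
    softmax a z k ≤ Real.exp (2 * β) * softmax a z' k := by
  have hexp : ∀ {z z' : Fin T → ℝ}, (∀ k, |z k - z' k| ≤ β) → ∀ k,
      (if a k then Real.exp (z k) else 0) ≤ Real.exp β * if a k then Real.exp (z' k) else 0 := by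
    intro z z' h k
    split_ifs
    · rw [← Real.exp_add]
      exact Real.exp_le_exp.2 (by linarith [(abs_le.1 (h k)).2])
    · simp
  have hden : ∑ l, (if a l then Real.exp (z' l) else 0)
      ≤ Real.exp β * ∑ l, if a l then Real.exp (z l) else 0 := by
    rw [Finset.mul_sum]
    exact Finset.sum_le_sum fun l _ => hexp (fun k => by rw [abs_sub_comm]; exact h k) l
  have hp := softmax_denom_pos ha z
  have hp' := softmax_denom_pos ha z'
  unfold softmax
  rw [mul_div_assoc', div_le_div_iff₀ hp hp']
  have h2 : Real.exp (2 * β) = Real.exp β * Real.exp β := by rw [← Real.exp_add]; ring_nf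
  calc _ ≤ (Real.exp β * if a k then Real.exp (z' k) else 0)
        * (Real.exp β * ∑ l, if a l then Real.exp (z l) else 0) :=
        mul_le_mul (hexp h k) hden hp'.le (by split_ifs <;> positivity)
    _ = _ := by rw [h2]; ring

/-- The entrywise comparison is multiplicative and the weights sum to one, so the total variation is
bounded independently of `T`. -/
lemma sum_abs_softmax_sub_le (ha : ∃ k, a k = true) {z z' : Fin T → ℝ} {β : ℝ}
    (h : ∀ k, |z k - z' k| ≤ β) :
    ∑ k, |softmax a z k - softmax a z' k| ≤ Real.exp (2 * β) - 1 := by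
  have hβ : 0 ≤ β := by obtain ⟨k, -⟩ := ha; exact (abs_nonneg _).trans (h k)
  have he : 1 ≤ Real.exp (2 * β) := Real.one_le_exp (by positivity)
  calc _ ≤ ∑ k, (Real.exp (2 * β) - 1) * softmax a z k := by
        refine Finset.sum_le_sum fun k _ => ?_
        have h1 := softmax_le_exp_mul ha h k
        have h2 := softmax_le_exp_mul ha (fun k => by rw [abs_sub_comm]; exact h k :
          ∀ k, |z' k - z k| ≤ β) k
        have h3 := softmax_nonneg a z k
        rw [abs_le]
        constructor
        · linarith
        · rcases le_total (softmax a z k) (softmax a z' k) with h4 | h4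
          · nlinarith
          · nlinarith
    _ = _ := by rw [← Finset.mul_sum, sum_softmax ha, mul_one]

end Softmax

/-! ### Perturbation of the attention -/

section Attention

variable {H d dK dV T : ℕ}

/-- An attention head written in terms of the bilinear form `G` of the logits and the product `P`
of the value and output projections. -/
def attnCore (G P : Matrix (Fin d) (Fin d) ℝ) (X : Matrix (Fin T) (Fin d) ℝ)
    (a : Fin T → Fin T → Bool) (i : Fin T) : Fin d → ℝ :=
  ∑ k, softmax (a i) (fun k => (X i ᵥ* G) ⬝ᵥ X k) k • (X k ᵥ* P)

/-- The bilinear form of the logits of head `j`. -/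
def MHAWeights.form (W : MHAWeights H d dK dV) (j : Fin H) : Matrix (Fin d) (Fin d) ℝ :=
  (√(dK : ℝ))⁻¹ • (W.Q j * (W.K j)ᵀ)

/-- This removes the key and value dimensions, so that source and target heads can be compared
through `d × d` matrices. -/
lemma MHAWeights.attn_eq (W : MHAWeights H d dK dV) (X : Matrix (Fin T) (Fin d) ℝ)
    (a : Fin T → Fin T → Bool) (i : Fin T) :
    W.attn X a i = ∑ j, attnCore (W.form j) (W.V j * W.O j) X a i := by
  refine Finset.sum_congr rfl fun j _ => ?_
  rw [MHAWeights.head, Matrix.vecMul_vecMul, Matrix.mul_assoc, Matrix.vecMul_eq_sum, attnCore]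
  refine Finset.sum_congr rfl fun k _ => ?_
  have h1 : (√(dK : ℝ))⁻¹ • ((X i ᵥ* W.Q j) ᵥ* (X * W.K j)ᵀ)
      = fun k => (X i ᵥ* W.form j) ⬝ᵥ X k := by
    funext k
    rw [MHAWeights.form, Matrix.vecMul_smul, smul_dotProduct, Pi.smul_apply,
      Matrix.transpose_mul, ← Matrix.vecMul_vecMul, ← Matrix.vecMul_vecMul]
    rfl
  rw [h1]
  congr 1

lemma l2norm_attnCore_le {G P : Matrix (Fin d) (Fin d) ℝ} (hP : specNorm P ≤ 1)
    {X : Matrix (Fin T) (Fin d) ℝ} {a : Fin T → Fin T → Bool} {α : ℝ}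
    (hX : ∀ i, l2norm (X i) ≤ α) (i : Fin T) (ha : ∃ k, a i k = true) :
    l2norm (attnCore G P X a i) ≤ α := by
  refine (l2norm_sum_le _ _).trans ?_
  calc _ ≤ ∑ k, softmax (a i) (fun k => (X i ᵥ* G) ⬝ᵥ X k) k * α := by
        refine Finset.sum_le_sum fun k _ => ?_
        rw [l2norm_smul, abs_of_nonneg (softmax_nonneg _ _ _)]
        refine mul_le_mul_of_nonneg_left ?_ (softmax_nonneg _ _ _)
        exact (l2norm_vecMul_le P (X k)).trans
          ((mul_le_of_le_one_left (l2norm_nonneg _) hP).trans (hX k))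
    _ = α := by rw [← Finset.sum_mul, sum_softmax ha, one_mul]

/-- The logits move by at most `α ^ 2 * d * η`, which costs `4 * α ^ 3 * d * η` through the softmax;
the change of `P` costs `d * η * α`. -/
lemma l2norm_attnCore_sub_le {G P G' P' : Matrix (Fin d) (Fin d) ℝ} (hP : specNorm P ≤ 1) {η : ℝ}
    (hη : 0 ≤ η) (hG' : ∀ r s, |G' r s - G r s| ≤ η) (hP' : ∀ r s, |P' r s - P r s| ≤ η)
    {X : Matrix (Fin T) (Fin d) ℝ} {a : Fin T → Fin T → Bool} {α : ℝ} (hα : 1 ≤ α)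
    (hsmall : 2 * (α ^ 2 * d * η) ≤ 1)
    (hX : ∀ i, l2norm (X i) ≤ α) (i : Fin T) (ha : ∃ k, a i k = true) :
    l2norm (attnCore G' P' X a i - attnCore G P X a i) ≤ 5 * α ^ 3 * d * η := by
  have hα0 : 0 ≤ α := by linarith
  set z := fun k => (X i ᵥ* G) ⬝ᵥ X k
  set z' := fun k => (X i ᵥ* G') ⬝ᵥ X k
  have hz : ∀ k, |z' k - z k| ≤ α ^ 2 * d * η := fun k => by
    have h1 : z' k - z k = (X i ᵥ* (G' - G)) ⬝ᵥ X k := by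
      rw [Matrix.vecMul_sub, sub_dotProduct]
    rw [h1]
    calc _ ≤ l2norm (X i ᵥ* (G' - G)) * l2norm (X k) := abs_dotProduct_le _ _
      _ ≤ (d * η * α) * α := by
          have h2 := l2norm_vecMul_le_of_entries (E := G' - G) hη hG' (X i)
          gcongr
          · exact l2norm_nonneg _
          · exact h2.trans (by gcongr; exact hX i)
          · exact hX k
      _ = _ := by ring
  have hsum := sum_abs_softmax_sub_le ha hz
  have hexp : Real.exp (2 * (α ^ 2 * d * η)) - 1 ≤ 2 * (2 * (α ^ 2 * d * η)) := by
    have h0 : 0 ≤ 2 * (α ^ 2 * d * η) := by positivity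
    have := Real.abs_exp_sub_one_le (x := 2 * (α ^ 2 * d * η)) (by rwa [abs_of_nonneg h0])
    rw [abs_of_nonneg h0] at this
    exact (le_abs_self _).trans this
  -- The change of the softmax is paired with `P`, whose norm is at most one, and the new softmax
  -- with `P' - P`; no bound on `P'` itself is needed.
  have hsplit : attnCore G' P' X a i - attnCore G P X a i
      = ∑ k, (softmax (a i) z' k - softmax (a i) z k) • (X k ᵥ* P)
        + ∑ k, softmax (a i) z' k • (X k ᵥ* (P' - P)) := by
    simp only [attnCore, ← Finset.sum_sub_distrib, ← Finset.sum_add_distrib]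
    refine Finset.sum_congr rfl fun k _ => ?_
    rw [Matrix.vecMul_sub, sub_smul, smul_sub]
    abel
  have hb1 : l2norm (∑ k, (softmax (a i) z' k - softmax (a i) z k) • (X k ᵥ* P))
      ≤ 2 * (2 * (α ^ 2 * d * η)) * α := by
    refine (l2norm_sum_le _ _).trans ?_
    calc _ ≤ ∑ k, |softmax (a i) z' k - softmax (a i) z k| * α := by
          refine Finset.sum_le_sum fun k _ => ?_
          rw [l2norm_smul]
          gcongr
          exact (l2norm_vecMul_le P (X k)).trans
            ((mul_le_of_le_one_left (l2norm_nonneg _) hP).trans (hX k))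
      _ ≤ _ := by
          rw [← Finset.sum_mul]
          gcongr
          exact hsum.trans hexp
  have hb2 : l2norm (∑ k, softmax (a i) z' k • (X k ᵥ* (P' - P))) ≤ d * η * α := by
    refine (l2norm_sum_le _ _).trans ?_
    calc _ ≤ ∑ k, softmax (a i) z' k * (d * η * α) := by
          refine Finset.sum_le_sum fun k _ => ?_
          rw [l2norm_smul, abs_of_nonneg (softmax_nonneg _ _ _)]
          refine mul_le_mul_of_nonneg_left ?_ (softmax_nonneg _ _ _)
          refine (l2norm_vecMul_le_of_entries (E := P' - P) hη hP' (X k)).trans ?_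
          gcongr
          exact hX k
      _ = _ := by rw [← Finset.sum_mul, sum_softmax ha, one_mul]
  rw [hsplit]
  refine (l2norm_add_le _ _).trans ((add_le_add hb1 hb2).trans ?_)
  have h3 : α ≤ α ^ 3 := le_self_pow₀ hα (by norm_num)
  have h4 : d * η * α ≤ d * η * α ^ 3 := by gcongr
  nlinarith

end Attention

/-! ### Perturbation of the fully-connected network and of the block -/

section FullyConnected

variable {L d m : ℕ}

lemma l2norm_targetFC_sub_le (W : Fin L → Matrix (Fin d) (Fin d) ℝ) (hW : ∀ l, specNorm (W l) ≤ 1)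
    (x y : Fin d → ℝ) : l2norm (targetFC W x - targetFC W y) ≤ l2norm (x - y) := by
  have hlin : ∀ (M : Matrix (Fin d) (Fin d) ℝ), specNorm M ≤ 1 → ∀ x y : Fin d → ℝ,
      l2norm (M *ᵥ x - M *ᵥ y) ≤ l2norm (x - y) := fun M hM x y => by
    rw [← Matrix.mulVec_sub]
    exact (l2norm_mulVec_le _ _).trans (mul_le_of_le_one_left (l2norm_nonneg _) hM)
  induction L generalizing x y with
  | zero => exact le_rfl
  | succ L ih =>
    cases L with
    | zero => exact hlin _ (hW 0) x y
    | succ L =>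
      exact (ih (fun l => W l.succ) (fun l => hW _) _ _).trans
        ((l2norm_relu_sub_le _ _).trans (hlin _ (hW 0) x y))

/-- After one layer the input has norm at most `(1 + κ) * l2norm x`, and its error `κ * l2norm x`
passes through the remaining target layers, which are 1-Lipschitz. The factor `c` thus obeys `c ↦ c
* (1 + κ) + κ`, that is, `1 + c` is multiplied by `1 + κ`. -/
lemma l2norm_sourceFC_sub_le (W : Fin L → Matrix (Fin d) (Fin d) ℝ)
    (hW : ∀ l, specNorm (W l) ≤ 1) (A : Fin L → Matrix (Fin m) (Fin d) ℝ)
    (B : Fin L → Matrix (Fin d) (Fin m) ℝ) {κ : ℝ} (hκ : 0 ≤ κ)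
    (h : ∀ l x, l2norm (B l *ᵥ relu (A l *ᵥ x) - W l *ᵥ x) ≤ κ * l2norm x) (x : Fin d → ℝ) :
    l2norm (sourceFC A B x - targetFC W x) ≤ ((1 + κ) ^ L - 1) * l2norm x := by
  induction L generalizing x with
  | zero => simp [sourceFC, targetFC, l2norm]
  | succ L ih =>
    cases L with
    | zero => simpa [sourceFC, targetFC] using h 0 x
    | succ L =>
      set y' := relu (B 0 *ᵥ relu (A 0 *ᵥ x)) with hy'
      set y := relu (W 0 *ᵥ x) with hy
      have h1 : l2norm (y' - y) ≤ κ * l2norm x := (l2norm_relu_sub_le _ _).trans (h 0 x)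
      have h2 : l2norm y' ≤ (1 + κ) * l2norm x := by
        have h3 : l2norm y ≤ l2norm x := (l2norm_relu_le _).trans
          ((l2norm_mulVec_le _ _).trans (mul_le_of_le_one_left (l2norm_nonneg _) (hW 0)))
        have h4 := l2norm_add_le (y' - y) y
        rw [sub_add_cancel] at h4
        linarith
      have h5 := ih (fun l => W l.succ) (fun l => hW _) (fun l => A l.succ) (fun l => B l.succ)
        (fun l => h _) y'
      have h6 := l2norm_targetFC_sub_le (fun l => W l.succ) (fun l => hW _) y' y
      have h7 := l2norm_add_le
        (sourceFC (fun l => A l.succ) (fun l => B l.succ) y' - targetFC (fun l => W l.succ) y')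
        (targetFC (fun l => W l.succ) y' - targetFC (fun l => W l.succ) y)
      rw [sub_add_sub_cancel] at h7
      have h8 : 0 ≤ (1 + κ) ^ (L + 1) - 1 := by
        have := one_le_pow₀ (n := L + 1) (by linarith : 1 ≤ 1 + κ)
        linarith
      have h9 := mul_le_mul_of_nonneg_left h2 h8
      change l2norm (sourceFC (fun l => A l.succ) (fun l => B l.succ) y'
        - targetFC (fun l => W l.succ) y) ≤ _
      calc _ ≤ ((1 + κ) ^ (L + 1) - 1) * ((1 + κ) * l2norm x) + κ * l2norm x := by linarith
        _ = _ := by ring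

end FullyConnected

/-- The attention error counts twice, once in the residual term and once through the 1-Lipschitz
target network. The network error is measured at the source's own input. -/
lemma l2norm_block_sub_le {H L d dK dV n m T : ℕ} {W : TargetWeights H L d dK dV}
    (hW : W.NormLeOne) {S : SourceWeights H L d n m} {α η κ : ℝ} (hα : 1 ≤ α) (hH : 1 ≤ H)
    (hη : 0 ≤ η)
    (hκ : 0 ≤ κ) (hform : ∀ j r s, |S.mha.form j r s - W.mha.form j r s| ≤ η)
    (hVO : ∀ j r s, |(S.mha.V j * S.mha.O j) r s - (W.mha.V j * W.mha.O j) r s| ≤ η)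
    (hfc : ∀ l x, l2norm (S.fcEven l *ᵥ relu (S.fcOdd l *ᵥ x) - W.fc l *ᵥ x) ≤ κ * l2norm x)
    (hηs : 5 * H * α ^ 3 * d * η ≤ 1) (hκs : κ * L ≤ 1)
    {X : Matrix (Fin T) (Fin d) ℝ} {a : Fin T → Fin T → Bool}
    (hX : ∀ i, l2norm (X i) ≤ α) (ha : ∀ i, ∃ k, a i k = true) (i : Fin T) :
    l2norm (S.block X a i - W.block X a i)
      ≤ 10 * H * α ^ 3 * d * η + 2 * (κ * L) * (3 * H * α) := by
  have hα0 : 0 ≤ α := by linarith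
  have hH' : (1 : ℝ) ≤ H := by exact_mod_cast hH
  have hVOn : ∀ j, specNorm (W.mha.V j * W.mha.O j) ≤ 1 := fun j => by
    obtain ⟨-, -, h1, h2⟩ := hW.1 j
    exact (specNorm_mul_le _ _).trans (mul_le_one₀ h1 (specNorm_nonneg _) h2)
  have hsmall : 2 * (α ^ 2 * d * η) ≤ 1 := by
    have h1 : α ^ 2 * d * η ≤ H * α ^ 3 * d * η := by
      gcongr
      calc α ^ 2 ≤ α ^ 3 := pow_le_pow_right₀ hα (by norm_num)
        _ ≤ H * α ^ 3 := le_mul_of_one_le_left (by positivity) hH'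
    have h2 : 0 ≤ H * α ^ 3 * d * η := by positivity
    linarith
  set e := 5 * H * α ^ 3 * d * η with he
  have hattn : l2norm (S.mha.attn X a i - W.mha.attn X a i) ≤ e := by
    rw [MHAWeights.attn_eq, MHAWeights.attn_eq, ← Finset.sum_sub_distrib]
    refine (l2norm_sum_le _ _).trans ((Finset.sum_le_sum fun j _ => l2norm_attnCore_sub_le
      (hVOn j) hη (hform j) (hVO j) hα hsmall hX i (ha i)).trans_eq ?_)
    simp [he]; ring
  have hattnT : l2norm (W.mha.attn X a i) ≤ H * α := by
    rw [MHAWeights.attn_eq]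
    refine (l2norm_sum_le _ _).trans ((Finset.sum_le_sum fun j _ => l2norm_attnCore_le
      (hVOn j) hX i (ha i)).trans_eq (by simp))
  set y' := S.mha.attn X a i + X i with hy'
  set y := W.mha.attn X a i + X i with hy
  have hyy : l2norm (y' - y) ≤ e := by
    rwa [hy', hy, add_sub_add_right_eq_sub]
  have hy'n : l2norm y' ≤ 3 * H * α := by
    have h1 := l2norm_add_le (y' - y) y
    rw [sub_add_cancel] at h1
    have h2 := l2norm_add_le (W.mha.attn X a i) (X i)
    have h3 := hX i
    have h4 : 1 ≤ H * α := one_le_mul_of_one_le_of_one_le hH' hα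
    have h5 : α ≤ H * α := le_mul_of_one_le_left hα0 hH'
    linarith
  have hpow : (1 + κ) ^ L - 1 ≤ 2 * (κ * L) := by
    have h1 : (1 + κ) ^ L ≤ Real.exp (κ * L) := by
      rw [mul_comm, Real.exp_nat_mul]
      gcongr
      linarith [Real.add_one_le_exp κ]
    have h0 : 0 ≤ κ * L := by positivity
    have h2 := Real.abs_exp_sub_one_le (x := κ * L) (by rwa [abs_of_nonneg h0])
    rw [abs_of_nonneg h0] at h2
    linarith [le_abs_self (Real.exp (κ * L) - 1)]
  have hfcS := l2norm_sourceFC_sub_le W.fc hW.2 S.fcOdd S.fcEven hκ hfc y'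
  have hfcT := l2norm_targetFC_sub_le W.fc hW.2 y' y
  have hblock : S.block X a i - W.block X a i
      = (sourceFC S.fcOdd S.fcEven y' - targetFC W.fc y')
        + (targetFC W.fc y' - targetFC W.fc y) + (y' - y) := by
    simp only [SourceWeights.block, TargetWeights.block, hy', hy]
    abel
  have h1 := l2norm_add_le ((sourceFC S.fcOdd S.fcEven y' - targetFC W.fc y')
        + (targetFC W.fc y' - targetFC W.fc y)) (y' - y)
  have h2 := l2norm_add_le (sourceFC S.fcOdd S.fcEven y' - targetFC W.fc y')
    (targetFC W.fc y' - targetFC W.fc y)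
  have h3 : ((1 + κ) ^ L - 1) * l2norm y' ≤ 2 * (κ * L) * (3 * H * α) := by
    gcongr
    exact l2norm_nonneg _
  rw [hblock]
  linarith

/-! ### Pruning masks realising subset sums -/

section Masks

lemma sum_ite_range {κ : Type*} [Fintype κ] {n : ℕ} {h : κ → Fin n} (hh : h.Injective)
    (f : Fin n → ℝ) [DecidablePred fun c => ∃ τ, h τ = c] :
    ∑ c, (if ∃ τ, h τ = c then f c else 0) = ∑ τ, f (h τ) := by
  classical
  rw [← Finset.sum_filter, ← Finset.sum_image fun x _ y _ hxy => hh hxy]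
  congr 1
  ext c; simp

variable {d n : ℕ} {κ : Type*} [Fintype κ]

open Classical in
/-- The mask of the hidden units in group `r`. -/
def groupMask (e : Fin d × κ ↪ Fin n) (r : Fin d) (c : Fin n) : Bool :=
  decide (∃ τ, e (r, τ) = c)

open Classical in
/-- The mask of the hidden units selected, group by group, by `S`. -/
def selectMask (e : Fin d × κ ↪ Fin n) (S : Fin d → κ → Bool) (c : Fin n) : Bool :=
  decide (∃ p : Fin d × κ, e p = c ∧ S p.1 p.2 = true)

lemma groupMask_apply (e : Fin d × κ ↪ Fin n) (r s : Fin d) (τ : κ) :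
    groupMask e r (e (s, τ)) = decide (r = s) := by
  simp [groupMask]

lemma selectMask_apply (e : Fin d × κ ↪ Fin n) (S : Fin d → κ → Bool) (r : Fin d) (τ : κ) :
    selectMask e S (e (r, τ)) = S r τ := by
  simp [selectMask]

/-- The inner product of a row pruned to group `r` with a column pruned by `S`. -/
lemma sum_prune_mul (e : Fin d × κ ↪ Fin n) (u v : Fin n → ℝ) (S : Fin d → κ → Bool) (r : Fin d) :
    ∑ c, (u c * if groupMask e r c then 1 else 0) * (v c * if selectMask e S c then 1 else 0)
      = subsetSum (fun τ => v (e (r, τ)) * u (e (r, τ))) (S r) := by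
  classical
  have h1 : ∀ c, (u c * if groupMask e r c then 1 else 0)
      * (v c * if selectMask e S c then 1 else 0)
      = if ∃ τ, e (r, τ) = c then u c * (v c * if selectMask e S c then 1 else 0) else 0 := by
    intro c
    by_cases h : ∃ τ, e (r, τ) = c <;> simp [groupMask, h]
  have hinj : Function.Injective fun τ => e (r, τ) := fun τ τ' h => by simpa using h
  rw [Finset.sum_congr rfl fun c _ => h1 c, sum_ite_range hinj, subsetSum]
  refine Finset.sum_congr rfl fun τ _ => ?_
  rw [selectMask_apply]
  split_ifs <;> ring

/-- A pruned two-layer network, as a combination of positive and negative parts of its input. -/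
lemma sum_prune_relu (e : Fin d × κ ↪ Fin n) (A : Fin n → Fin d → ℝ) (v : Fin n → ℝ)
    (Sp Sn : Fin d → κ → Bool) (x : Fin d → ℝ) :
    ∑ c, (v c * if selectMask e (fun s τ => if 0 < A (e (s, τ)) s then Sp s τ else Sn s τ) c
          then 1 else 0)
        * max (∑ s, (A c s * if groupMask e s c then 1 else 0) * x s) 0
      = ∑ s, (subsetSum (fun τ => v (e (s, τ)) * max (A (e (s, τ)) s) 0) (Sp s) * max (x s) 0
          + subsetSum (fun τ => v (e (s, τ)) * max (-A (e (s, τ)) s) 0) (Sn s)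
            * max (-x s) 0) := by
  classical
  set S : Fin d → κ → Bool := fun s τ => if 0 < A (e (s, τ)) s then Sp s τ else Sn s τ
  set F : Fin n → ℝ := fun c => max (∑ s, (A c s * if groupMask e s c then 1 else 0) * x s) 0
  have h1 : ∀ c, (v c * if selectMask e S c then 1 else 0) * F c
      = if ∃ p, e p = c then (v c * if selectMask e S c then 1 else 0) * F c else 0 := by
    intro c
    by_cases h : ∃ p, e p = c
    · rw [if_pos h]
    · rw [if_neg h]
      have : selectMask e S c = false := by
        simp only [selectMask, decide_eq_false_iff_not]
        rintro ⟨p, hp, -⟩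
        exact h ⟨p, hp⟩
      simp [this]
  rw [Finset.sum_congr rfl fun c _ => h1 c, sum_ite_range e.injective, Fintype.sum_prod_type]
  refine Finset.sum_congr rfl fun s _ => ?_
  rw [subsetSum, subsetSum, Finset.sum_mul, Finset.sum_mul, ← Finset.sum_add_distrib]
  refine Finset.sum_congr rfl fun τ _ => ?_
  have h2 : F (e (s, τ)) = max (A (e (s, τ)) s * x s) 0 := by
    simp only [F, groupMask_apply]
    congr 1
    rw [Finset.sum_eq_single s]
    · simp
    · intro s' _ hs; simp [hs]
    · simp
  rw [selectMask_apply, h2]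
  -- Only one of the two products attached to a unit is nonzero, so the selections `Sp` and `Sn`
  -- never compete for it.
  rcases lt_or_ge 0 (A (e (s, τ)) s) with ha | ha
  · have hSp : S s τ = Sp s τ := if_pos ha
    generalize A (e (s, τ)) s = a at ha
    rw [hSp, max_eq_left ha.le, max_eq_right (by linarith : -a ≤ 0),
      show max (a * x s) 0 = a * max (x s) 0 by rw [mul_max_of_nonneg _ _ ha.le, mul_zero]]
    split_ifs <;> ring
  · have hSn : S s τ = Sn s τ := if_neg (not_lt.2 ha)
    generalize A (e (s, τ)) s = a at ha
    rw [hSn, max_eq_right ha, max_eq_left (by linarith : 0 ≤ -a),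
      show max (a * x s) 0 = -a * max (-x s) 0 by
        rw [mul_max_of_nonneg _ _ (by linarith : 0 ≤ -a), mul_zero, neg_mul_neg]]
    split_ifs <;> ring

end Masks

/-- If the relevant families of products approximate `[-1, 1]` by subset sums, then some pruning of
the source weights approximates the target weights. -/
lemma exists_mask {H L d dK dV n m : ℕ} {κM κF : Type*} [Fintype κM] [Fintype κF] (hn : 1 ≤ n)
    (hdK : 1 ≤ dK)
    {W : TargetWeights H L d dK dV} (hW : W.NormLeOne) (w : SourceIndex H L d n m → ℝ)
    (e : Fin d × κM ↪ Fin n) (f : Fin d × κF ↪ Fin m) {ηM ηF : ℝ} (hηF : 0 ≤ ηF)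
    (hQK : ∀ j r s, Approximates (fun τ => w (.K j s (e (r, τ))) / (n : ℝ) ^ (1 / 4 : ℝ)
      * (w (.Q j r (e (r, τ))) / (n : ℝ) ^ (1 / 4 : ℝ))) ηM)
    (hVO : ∀ j r s, Approximates (fun τ => w (.O j (e (r, τ)) s) * w (.V j r (e (r, τ)))) ηM)
    (hp : ∀ l r s, Approximates
      (fun τ => w (.fcEven l r (f (s, τ))) * max (w (.fcOdd l (f (s, τ)) s)) 0) ηF)
    (hq : ∀ l r s, Approximates
      (fun τ => w (.fcEven l r (f (s, τ))) * max (-w (.fcOdd l (f (s, τ)) s)) 0) ηF) :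
    ∃ M : SourceIndex H L d n m → Bool,
      (∀ j r s, |(SourceWeights.ofEntries (prune w M)).mha.form j r s - W.mha.form j r s| ≤ ηM) ∧
      (∀ j r s, |((SourceWeights.ofEntries (prune w M)).mha.V j
        * (SourceWeights.ofEntries (prune w M)).mha.O j) r s
        - (W.mha.V j * W.mha.O j) r s| ≤ ηM) ∧
      ∀ l x, l2norm ((SourceWeights.ofEntries (prune w M)).fcEven l
        *ᵥ relu ((SourceWeights.ofEntries (prune w M)).fcOdd l *ᵥ x) - W.fc l *ᵥ x)
        ≤ 2 * d * ηF * l2norm x := by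
  have hform : ∀ j r s, |W.mha.form j r s| ≤ 1 := fun j r s => by
    obtain ⟨h1, h2, -, -⟩ := hW.1 j
    refine (abs_entry_le_specNorm _ r s).trans ?_
    rw [MHAWeights.form, specNorm_smul]
    refine mul_le_one₀ ?_ (specNorm_nonneg _) ((specNorm_mul_le _ _).trans
      (mul_le_one₀ h1 (specNorm_nonneg _) (by rwa [specNorm_transpose])))
    rw [abs_of_nonneg (by positivity)]
    exact inv_le_one_of_one_le₀ (Real.one_le_sqrt.2 (by exact_mod_cast hdK))
  have hVOn : ∀ j r s, |(W.mha.V j * W.mha.O j) r s| ≤ 1 := fun j r s => by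
    obtain ⟨-, -, h1, h2⟩ := hW.1 j
    exact (abs_entry_le_specNorm _ r s).trans ((specNorm_mul_le _ _).trans
      (mul_le_one₀ h1 (specNorm_nonneg _) h2))
  have hfcn : ∀ l r s, |W.fc l r s| ≤ 1 := fun l r s =>
    (abs_entry_le_specNorm _ r s).trans (hW.2 l)
  choose SM hSM using fun j r s => hQK j r s _ (hform j r s)
  choose SV hSV using fun j r s => hVO j r s _ (hVOn j r s)
  choose Sp hSp using fun l r s => hp l r s _ (hfcn l r s)
  choose Sq hSq using fun l r s => hq l r s (-W.fc l r s) (by rw [abs_neg]; exact hfcn l r s)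
  -- Each mask entry of `K`, `O` and `fcEven` belongs to one group and one row or column, hence to
  -- one matrix entry, so all the selections can be made at the same time.
  let M : SourceIndex H L d n m → Bool := fun
    | .Q _ r c => groupMask e r c
    | .K j s c => selectMask e (fun r => SM j r s) c
    | .V _ r c => groupMask e r c
    | .O j c s => selectMask e (fun r => SV j r s) c
    | .fcOdd _ c s => groupMask f s c
    | .fcEven l r c => selectMask f
        (fun s τ => if 0 < w (.fcOdd l (f (s, τ)) s) then Sp l r s τ else Sq l r s τ) c
  refine ⟨M, fun j r s => ?_, fun j r s => ?_, fun l x => ?_⟩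
  · refine le_of_eq_of_le ?_ (hSM j r s)
    congr 2
    have h1 := sum_prune_mul e (fun c => w (.Q j r c)) (fun c => w (.K j s c)) (fun r => SM j r s) r
    have hn0 : (0 : ℝ) ≤ n := by positivity
    -- The rescalings of the query and key weights to `[-1, 1]` combine to exactly the `√n` dividing
    -- the logits.
    have h2 : (n : ℝ) ^ (1 / 4 : ℝ) * (n : ℝ) ^ (1 / 4 : ℝ) = √(n : ℝ) := by
      rw [← Real.rpow_add (by exact_mod_cast hn), Real.sqrt_eq_rpow]; norm_num
    simp only [MHAWeights.form, Matrix.smul_apply, Matrix.mul_apply, Matrix.transpose_apply,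
      smul_eq_mul, SourceWeights.ofEntries, Matrix.of_apply, prune, M]
    rw [h1, subsetSum, subsetSum, Finset.mul_sum]
    refine Finset.sum_congr rfl fun τ _ => ?_
    rw [div_mul_div_comm, h2]
    split_ifs
    · rw [inv_mul_eq_div]
    · simp
  · refine le_of_eq_of_le ?_ (hSV j r s)
    congr 2
    exact sum_prune_mul e (fun c => w (.V j r c)) (fun c => w (.O j c s)) (fun r => SV j r s) r
  · set Ep : Matrix (Fin d) (Fin d) ℝ := Matrix.of fun r s => subsetSum (fun τ =>
      w (.fcEven l r (f (s, τ))) * max (w (.fcOdd l (f (s, τ)) s)) 0) (Sp l r s) - W.fc l r s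
    set Eq : Matrix (Fin d) (Fin d) ℝ := Matrix.of fun r s => subsetSum (fun τ =>
      w (.fcEven l r (f (s, τ))) * max (-w (.fcOdd l (f (s, τ)) s)) 0) (Sq l r s) - -W.fc l r s
    have h1 : (SourceWeights.ofEntries (prune w M)).fcEven l
        *ᵥ relu ((SourceWeights.ofEntries (prune w M)).fcOdd l *ᵥ x) - W.fc l *ᵥ x
        = Ep *ᵥ relu x + Eq *ᵥ relu (-x) := by
      funext r
      have h2 := sum_prune_relu f (fun c s => w (.fcOdd l c s)) (fun c => w (.fcEven l r c))
        (Sp l r) (Sq l r) x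
      have h3 : ((SourceWeights.ofEntries (prune w M)).fcEven l
          *ᵥ relu ((SourceWeights.ofEntries (prune w M)).fcOdd l *ᵥ x)) r = _ := h2
      rw [Pi.sub_apply, h3, Pi.add_apply]
      simp only [Matrix.mulVec, dotProduct, Ep, Eq, Matrix.of_apply, relu, Pi.neg_apply]
      rw [← Finset.sum_sub_distrib, ← Finset.sum_add_distrib]
      refine Finset.sum_congr rfl fun s _ => ?_
      have h4 : x s = max (x s) 0 - max (-x s) 0 := (max_zero_sub_eq_self (x s)).symm
      nth_rewrite 3 [h4]
      ring
    rw [h1]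
    refine (l2norm_add_le _ _).trans ?_
    have h5 := l2norm_mulVec_le_of_entries (E := Ep) hηF (fun r s => hSp l r s) (relu x)
    have h6 := l2norm_mulVec_le_of_entries (E := Eq) hηF (fun r s => hSq l r s) (relu (-x))
    have h7 := l2norm_relu_le x
    have h8 : l2norm (relu (-x)) ≤ l2norm x :=
      (l2norm_relu_le _).trans (l2norm_mono fun i => by simp)
    have h9 : 0 ≤ d * ηF := by positivity
    calc _ ≤ d * ηF * l2norm (relu x) + d * ηF * l2norm (relu (-x)) := add_le_add h5 h6
      _ ≤ d * ηF * l2norm x + d * ηF * l2norm x := by gcongr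
      _ = _ := by ring

/-! ### Union bound and number of hidden units -/

lemma measure_exists_le {Ω ι : Type*} [MeasurableSpace Ω] (μ : Measure Ω) [Fintype ι]
    (P : ι → Ω → Prop) {c : ℝ} (h : ∀ i, μ {ω | P i ω} ≤ ENNReal.ofReal c) :
    μ {ω | ∃ i, P i ω} ≤ ENNReal.ofReal (Fintype.card ι * c) := by
  have h1 : {ω | ∃ i, P i ω} = ⋃ i, {ω | P i ω} := by ext; simp
  rw [h1]
  refine (measure_iUnion_fintype_le _ _).trans ((Finset.sum_le_sum fun i _ => h i).trans_eq ?_)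
  rw [Finset.sum_const, Finset.card_univ, nsmul_eq_mul, ENNReal.ofReal_mul (by positivity),
    ENNReal.ofReal_natCast]

lemma exists_blocks {d n : ℕ} (hd : 1 ≤ d) {D : ℝ} (hD : 24 ≤ D)
    (h : (d : ℝ) * 776 * Real.log D ≤ n) :
    ∃ t : ℕ, 192 * Real.log D ≤ t ∧ Nonempty (Fin d × (Fin 4 × Fin t) ↪ Fin n) := by
  have hd0 : (0 : ℝ) < d := by exact_mod_cast hd
  have hlog : 1 ≤ Real.log D := by
    rw [Real.le_log_iff_exp_le (by linarith)]
    linarith [Real.exp_one_lt_d9]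
  refine ⟨n / (4 * d), ?_, Function.Embedding.nonempty_of_card_le ?_⟩
  -- Here `776 = 4 * 194`: the surplus `2 * log D` over `192 * log D` absorbs the rounding in `n /
  -- (4 * d)`.
  · have h1 : (n : ℝ) < (4 * d) * ((n / (4 * d) : ℕ) + 1) := by
      exact_mod_cast Nat.lt_mul_div_succ n (by omega : 0 < 4 * d)
    have h2 : (d : ℝ) * (776 * Real.log D) < d * (4 * ((n / (4 * d) : ℕ) + 1)) := by linarith
    have h3 := lt_of_mul_lt_mul_left h2 hd0.le
    linarith
  · simp only [Fintype.card_prod, Fintype.card_fin]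
    calc d * (4 * (n / (4 * d))) = 4 * d * (n / (4 * d)) := by ring
      _ ≤ n := Nat.mul_div_le _ _

lemma rpow_three_halves_eq {x : ℝ} (hx : 0 ≤ x) : x ^ (3 / 2 : ℝ) = √x ^ 3 := by
  rw [Real.sqrt_eq_rpow, ← Real.rpow_natCast, ← Real.rpow_mul hx]; norm_num

lemma rpow_five_halves_eq {x : ℝ} (hx : 0 ≤ x) : x ^ (5 / 2 : ℝ) = √x ^ 5 := by
  rw [Real.sqrt_eq_rpow, ← Real.rpow_natCast, ← Real.rpow_mul hx]; norm_num

/-- The probability that some entry of a head or a layer is not approximated by subset sums of the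
products of source weights assigned to it. -/
lemma measure_not_all_approximate_le {H L d n m : ℕ} {Ω : Type*} [MeasurableSpace Ω]
    {μ : Measure Ω} {w : SourceIndex H L d n m → Ω → ℝ} (hw : IsRandomInit μ w) (hn : 1 ≤ n)
    {t u : ℕ} {D E : ℝ} (hD : 24 ≤ D) (hE : 24 ≤ E) (ht : 192 * Real.log D ≤ t)
    (hu : 192 * Real.log E ≤ u) (e : Fin d × (Fin 4 × Fin t) ↪ Fin n)
    (f : Fin d × (Fin 4 × Fin u) ↪ Fin m) :
    μ {ω | ¬ ((∀ j r s, Approximates (fun τ => w (.K j s (e (r, τ))) ω / (n : ℝ) ^ (1 / 4 : ℝ)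
        * (w (.Q j r (e (r, τ))) ω / (n : ℝ) ^ (1 / 4 : ℝ))) (1 / D)) ∧
      (∀ j r s, Approximates
        (fun τ => w (.O j (e (r, τ)) s) ω * w (.V j r (e (r, τ))) ω) (1 / D)) ∧
      (∀ l r s, Approximates
        (fun τ => w (.fcEven l r (f (s, τ))) ω * max (w (.fcOdd l (f (s, τ)) s) ω) 0) (1 / E)) ∧
      (∀ l r s, Approximates
        (fun τ => w (.fcEven l r (f (s, τ))) ω * max (-w (.fcOdd l (f (s, τ)) s) ω) 0) (1 / E)))}
      ≤ ENNReal.ofReal (8 * H * d ^ 2 / D + 8 * L * d ^ 2 / E) := by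
  have he : ∀ r, Function.Injective fun τ => e (r, τ) := fun r τ τ' h => by simpa using h
  have hf : ∀ s, Function.Injective fun τ => f (s, τ) := fun s τ τ' h => by simpa using h
  have hn4 : (0 : ℝ) < (n : ℝ) ^ (1 / 4 : ℝ) := Real.rpow_pos_of_pos (by exact_mod_cast hn) _
  have b1 := measure_exists_le μ (fun (i : Fin H × Fin d × Fin d) ω => ¬ Approximates
      (fun τ => w (.K i.1 i.2.2 (e (i.2.1, τ))) ω / (n : ℝ) ^ (1 / 4 : ℝ)
        * (w (.Q i.1 i.2.1 (e (i.2.1, τ))) ω / (n : ℝ) ^ (1 / 4 : ℝ))) (1 / D)) (c := 4 / D)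
    fun ⟨j, r, s⟩ => measure_not_approximates_le hw.measurable hw.indep hn4 (by linarith) ht
      (fun τ => .K j s (e (r, τ))) (fun τ => .Q j r (e (r, τ)))
      (fun τ τ' h => he r (by simpa using h)) (fun τ τ' h => he r (by simpa using h))
      (fun _ _ => by simp) (fun _ => hw.uniform _) (fun _ => hw.uniform _)
      (g := fun x => x) measurable_id (Or.inl rfl) (fun v _ => one_mul v)
  have b2 := measure_exists_le μ (fun (i : Fin H × Fin d × Fin d) ω => ¬ Approximates
      (fun τ => w (.O i.1 (e (i.2.1, τ)) i.2.2) ω * w (.V i.1 i.2.1 (e (i.2.1, τ))) ω) (1 / D))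
    (c := 4 / D)
    fun ⟨j, r, s⟩ => by
      have := measure_not_approximates_le hw.measurable hw.indep one_pos (by linarith) ht
        (fun τ => .O j (e (r, τ)) s) (fun τ => .V j r (e (r, τ)))
        (fun τ τ' h => he r (by simpa using h)) (fun τ τ' h => he r (by simpa using h))
        (fun _ _ => by simp) (fun _ => hw.uniform _) (fun _ => hw.uniform _)
        (g := fun x => x) measurable_id (Or.inl rfl) (fun v _ => one_mul v)
      simpa only [div_one] using this
  have b3 := measure_exists_le μ (fun (i : Fin L × Fin d × Fin d) ω => ¬ Approximates
      (fun τ => w (.fcEven i.1 i.2.1 (f (i.2.2, τ))) ω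
        * max (w (.fcOdd i.1 (f (i.2.2, τ)) i.2.2) ω) 0) (1 / E)) (c := 4 / E)
    fun ⟨l, r, s⟩ => by
      have := measure_not_approximates_le hw.measurable hw.indep one_pos (by linarith) hu
        (fun τ => .fcEven l r (f (s, τ))) (fun τ => .fcOdd l (f (s, τ)) s)
        (fun τ τ' h => hf s (by simpa using h)) (fun τ τ' h => hf s (by simpa using h))
        (fun _ _ => by simp) (fun _ => hw.uniform _) (fun _ => hw.uniform _)
        (g := fun x => max x 0) (by fun_prop) (Or.inl rfl)
        (fun v hv => by rw [one_mul]; exact max_eq_left (by linarith [hv.1]))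
      simpa only [div_one] using this
  -- The negative part is the identity after reflection, which is the case `s = -1` of the spread
  -- condition.
  have b4 := measure_exists_le μ (fun (i : Fin L × Fin d × Fin d) ω => ¬ Approximates
      (fun τ => w (.fcEven i.1 i.2.1 (f (i.2.2, τ))) ω
        * max (-w (.fcOdd i.1 (f (i.2.2, τ)) i.2.2) ω) 0) (1 / E)) (c := 4 / E)
    fun ⟨l, r, s⟩ => by
      have := measure_not_approximates_le hw.measurable hw.indep one_pos (by linarith) hu
        (fun τ => .fcEven l r (f (s, τ))) (fun τ => .fcOdd l (f (s, τ)) s)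
        (fun τ τ' h => hf s (by simpa using h)) (fun τ τ' h => hf s (by simpa using h))
        (fun _ _ => by simp) (fun _ => hw.uniform _) (fun _ => hw.uniform _)
        (g := fun x => max (-x) 0) (by fun_prop) (Or.inr rfl)
        (fun v hv => by rw [neg_one_mul, neg_neg]; exact max_eq_left (by linarith [hv.1]))
      simpa only [div_one] using this
  simp only [Fintype.card_prod, Fintype.card_fin] at b1 b2 b3 b4
  refine (measure_mono ?_).trans ((measure_union_le _ _).trans ((add_le_add
    ((measure_union_le _ _).trans (add_le_add b1 b2))
    ((measure_union_le _ _).trans (add_le_add b3 b4))).trans_eq ?_))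
  · intro ω hω
    by_contra hcon
    simp only [Set.mem_union, Set.mem_ofPred_eq, not_or, not_exists, not_not, Prod.forall] at hcon
    exact hω ⟨hcon.1.1, hcon.1.2, hcon.2.1, hcon.2.2⟩
  · have hD0 : 0 < D := by linarith
    have hE0 : 0 < E := by linarith
    rw [← ENNReal.ofReal_add (by positivity) (by positivity),
      ← ENNReal.ofReal_add (by positivity) (by positivity),
      ← ENNReal.ofReal_add (by positivity) (by positivity)]
    congr 1
    push_cast
    ring

end TransformerSLT
end

/-! ### Choice of the constant and assembly -/

theorem mainTheorem3 :
    ∃ C : ℝ, 0 < C ∧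
      ∀ (H L d dK dV n m : ℕ), 1 ≤ H → 1 ≤ L → 1 ≤ d → 1 ≤ dK →
      ∀ (α ε : ℝ), √(d : ℝ) ≤ α → 0 < ε → ε < 1 →
      (d : ℝ) * C * Real.log (32 * α ^ 3 * H * (d : ℝ) ^ (3 / 2 : ℝ) / ε) ≤ n →
      (d : ℝ) * C * Real.log (24 * α * L * H * (d : ℝ) ^ (5 / 2 : ℝ) / ε) ≤ m →
      ∀ (W : TransformerSLT.TargetWeights H L d dK dV), W.NormLeOne →
      ∀ {Ω : Type*} [MeasurableSpace Ω] (μ : MeasureTheory.Measure Ω)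
        [MeasureTheory.IsProbabilityMeasure μ]
        (w : TransformerSLT.SourceIndex H L d n m → Ω → ℝ),
        TransformerSLT.IsRandomInit μ w →
        ENNReal.ofReal (1 - ε) ≤
          μ {ω | ∃ M : TransformerSLT.SourceIndex H L d n m → Bool,
            ∀ (T : ℕ) (X : Matrix (Fin T) (Fin d) ℝ) (a : Fin T → Fin T → Bool),
              (∀ i, TransformerSLT.l2norm (X i) ≤ α) → (∀ i, ∃ k, a i k = true) →
              ∀ i, TransformerSLT.l2norm
                ((TransformerSLT.SourceWeights.ofEntries
                    (TransformerSLT.prune (fun p => w p ω) M)).block X a i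
                  - W.block X a i) ≤ ε} := by
  refine ⟨776, by norm_num, ?_⟩
  intro H L d dK dV n m hH hL hd hdK α ε hα hε hε1 hnM hnF W hW Ω _ μ _ w hw
  have hd0 : (0 : ℝ) ≤ d := by positivity
  rw [TransformerSLT.rpow_three_halves_eq hd0] at hnM
  rw [TransformerSLT.rpow_five_halves_eq hd0] at hnF
  have hs2 : (d : ℝ) = √(d : ℝ) ^ 2 := (Real.sq_sqrt hd0).symm
  have hs1 : 1 ≤ √(d : ℝ) := Real.one_le_sqrt.2 (by exact_mod_cast hd)
  have hH1 : (1 : ℝ) ≤ H := by exact_mod_cast hH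
  have hL1 : (1 : ℝ) ≤ L := by exact_mod_cast hL
  set s := √(d : ℝ)
  have hs0 : 0 < s := by linarith
  have hα1 : 1 ≤ α := hs1.trans hα
  have hα0 : 0 < α := by linarith
  set D := 32 * α ^ 3 * H * s ^ 3 / ε with hDdef
  set E := 24 * α * L * H * s ^ 5 / ε with hEdef
  have hD : 24 ≤ D := by
    rw [hDdef, le_div_iff₀ hε]
    have : 1 ≤ α ^ 3 * H * s ^ 3 := one_le_mul_of_one_le_of_one_le
      (one_le_mul_of_one_le_of_one_le (one_le_pow₀ hα1) hH1) (one_le_pow₀ hs1)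
    linarith
  have hE : 24 ≤ E := by
    rw [hEdef, le_div_iff₀ hε]
    have : 1 ≤ α * L * H * s ^ 5 := one_le_mul_of_one_le_of_one_le
      (one_le_mul_of_one_le_of_one_le (one_le_mul_of_one_le_of_one_le hα1 hL1) hH1)
      (one_le_pow₀ hs1)
    linarith
  have hD0 : 0 < D := by linarith
  have hE0 : 0 < E := by linarith
  obtain ⟨t, ht, ⟨e⟩⟩ := TransformerSLT.exists_blocks hd hD hnM
  obtain ⟨u, hu, ⟨f⟩⟩ := TransformerSLT.exists_blocks hd hE hnF
  have hn : 1 ≤ n := by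
    have h1 : 0 < Real.log D := Real.log_pos (by linarith)
    have h2 : (0 : ℝ) < n := lt_of_lt_of_le (by rw [hs2]; positivity) hnM
    exact_mod_cast h2
  have hbad := TransformerSLT.measure_not_all_approximate_le hw hn hD hE ht hu e f
  set good : Set Ω := {ω | ∃ M : TransformerSLT.SourceIndex H L d n m → Bool,
            ∀ (T : ℕ) (X : Matrix (Fin T) (Fin d) ℝ) (a : Fin T → Fin T → Bool),
              (∀ i, TransformerSLT.l2norm (X i) ≤ α) → (∀ i, ∃ k, a i k = true) →
              ∀ i, TransformerSLT.l2norm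
                ((TransformerSLT.SourceWeights.ofEntries
                    (TransformerSLT.prune (fun p => w p ω) M)).block X a i
                  - W.block X a i) ≤ ε}
  have hprob : 8 * H * (d : ℝ) ^ 2 / D + 8 * L * (d : ℝ) ^ 2 / E ≤ ε := by
    have h1 : 8 * H * (d : ℝ) ^ 2 / D = ε / 4 * (s / α ^ 3) := by
      rw [hDdef, hs2]; field_simp; norm_num
    have h2 : 8 * L * (d : ℝ) ^ 2 / E = ε / 3 * (1 / (α * H * s)) := by
      rw [hEdef, hs2]; field_simp; norm_num
    -- The assumption `√d ≤ α` enters here: the union bound over `d ^ 2` entries costs one more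
    -- power of `√d` than `D` provides.
    have h3 : s / α ^ 3 ≤ 1 := (div_le_one (by positivity)).2
      (hα.trans (le_self_pow₀ hα1 (by norm_num)))
    have h4 : 1 / (α * H * s) ≤ 1 := (div_le_one (by positivity)).2
      (one_le_mul_of_one_le_of_one_le (one_le_mul_of_one_le_of_one_le hα1 hH1) hs1)
    rw [h1, h2]
    nlinarith
  have hcompl : μ goodᶜ ≤ ENNReal.ofReal ε := by
    refine le_trans (MeasureTheory.measure_mono ?_)
      (hbad.trans (ENNReal.ofReal_le_ofReal hprob))
    intro ω hω hall
    refine hω ?_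
    obtain ⟨h1, h2, h3, h4⟩ := hall
    obtain ⟨M, hM1, hM2, hM3⟩ := TransformerSLT.exists_mask hn hdK hW (fun p => w p ω) e f
      (by positivity) h1 h2 h3 h4
    refine ⟨M, fun T X a hX ha i => ?_⟩
    have hκL : 2 * d * (1 / E) * L = ε / (12 * (α * H * s ^ 3)) := by
      rw [hEdef, hs2]; field_simp; norm_num
    have hη : H * α ^ 3 * d * (1 / D) = ε / (32 * s) := by
      rw [hDdef, hs2]; field_simp
    have hη' : ε / (32 * s) ≤ ε / 32 := by gcongr; linarith
    have hκL1 : 1 ≤ α * H * s ^ 3 := one_le_mul_of_one_le_of_one_le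
      (one_le_mul_of_one_le_of_one_le hα1 hH1) (one_le_pow₀ hs1)
    -- Attention contributes at most `10/32` of `ε` and the network at most half of it.
    have key := TransformerSLT.l2norm_block_sub_le hW hα1 hH (by positivity) (by positivity)
      hM1 hM2 hM3 (by linarith) (by rw [hκL, div_le_one (by positivity)]; linarith) hX ha i
    refine key.trans ?_
    have h5 : 2 * (2 * d * (1 / E) * L) * (3 * H * α) = ε / (2 * s ^ 3) := by
      rw [hκL]; field_simp; norm_num
    have h6 : ε / (2 * s ^ 3) ≤ ε / 2 := by
      gcongr
      linarith [one_le_pow₀ (n := 3) hs1]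
    linarith
  -- Subadditivity on `good` and its complement suffices, so measurability of `good` is never
  -- required.
  rw [ENNReal.ofReal_sub _ hε.le, ENNReal.ofReal_one, tsub_le_iff_right,
    ← MeasureTheory.measure_univ (μ := μ), ← Set.union_compl_self good]
  exact (MeasureTheory.measure_union_le _ _).trans (add_le_add_right hcompl _)
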